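/- The Linking-Unlinking Game is played on a shadow of a two-component link diagram (a diagram whose over/under information has been forgotten). Two players alternately choose an unresolved crossing and resolve it, i.e. choose which of its two strands is the overstrand, until every crossing is resolved. The Unlinker wins if the resulting link diagram is splittable, i.e. can be turned by planar isotopies and Reidemeister moves into a diagram for which some circle in the plane is disjoint from the diagram and has components of the link both inside and outside; otherwise the Linker wins. The rational tangle $(a_1,\dots,a_n)$, $a_i\in\mathbb{Z}$, is built from two parallel vertical strands by twisting, for $i=1,\dots,n$ in turn, the two bottom endpoints ($i$ odd) or the two right endpoints ($i$ even) $|a_i|$ times, the overstrand having positive slope if $a_i>0$ and negative slope if $a_i<0$. Its closures are obtained by joining the two top endpoints to each other and the two bottom endpoints to each other (numerator closure), or the two left endpoints to each other and the two right endpoints to each other (denominator closure). **Theorem.** Let $n\ge 3$, let $a_1$ and $a_n$ be odd and let $a_2,\dots,a_{n-1}$ be even integers. Consider a closure of the rational tangle $(a_1,\dots,a_n)$ that is a diagram of a two-component link. Then in the Linking-Unlinking Game on the shadow of this diagram the second player has a winning strategy, whether the second player is the Linker or the Unlinker. -/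

import Mathlib

namespace LinkGame

/-! Link diagrams in the plane are put in general position with respect to the height function and
read from top to bottom: such a diagram is a finite word of horizontal slices, and each slice holds
exactly one local maximum, one local minimum or one crossing besides vertical strands. -/

/-- The non-trivial part of a slice: a local maximum `∩`, a local minimum `∪`, or a crossing `X`
carrying a decoration in `κ`.  For diagrams `κ = Bool`, where `true` means that the overstrand has
positive slope and `false` that it has negative slope.  For pseudodiagrams `κ = Option Bool`, where
`none` is an unresolved crossing. -/
inductive Piece (κ : Type) : Type
  | cap : Piece κ
  | cup : Piece κ
  | cross (c : κ) : Piece κ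

/-- The number of strands entering a piece from above. -/
def Piece.inn {κ : Type} : Piece κ → ℕ
  | .cap => 0
  | .cup => 2
  | .cross _ => 2

/-- The number of strands leaving a piece below. -/
def Piece.out {κ : Type} : Piece κ → ℕ
  | .cap => 2
  | .cup => 0
  | .cross _ => 2

def Piece.map {κ κ' : Type} (f : κ → κ') : Piece κ → Piece κ'
  | .cap => .cap
  | .cup => .cup
  | .cross c => .cross (f c)

/-- A slice: the piece has exactly `pos` vertical strands on its left. -/
structure Slice (κ : Type) : Type where
  pos : ℕ
  piece : Piece κ

/-- A word of slices, the first one at the top. -/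
abbrev Word (κ : Type) : Type := List (Slice κ)

/-- Change the decorations of the crossings. -/
def Word.map {κ κ' : Type} (f : κ → κ') (w : Word κ) : Word κ' :=
  List.map (fun s => ⟨s.pos, s.piece.map f⟩) w

/-- Draw `k` additional vertical strands on the left of the word. -/
def Word.shift {κ : Type} (k : ℕ) (w : Word κ) : Word κ :=
  List.map (fun s => ⟨k + s.pos, s.piece⟩) w

/-- The number of strands at the bottom of the word when there are `m` strands at its top, or `none`
if some slice of the word does not fit. -/
def Word.run {κ : Type} : ℕ → Word κ → Option ℕ
  | m, [] => some m
  | m, s :: w =>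
      if s.pos + s.piece.inn ≤ m then Word.run (m - s.piece.inn + s.piece.out) w else none

/-- A link diagram, pseudodiagram or shadow, according to the decorations: a word of slices
that starts and ends with no strands. -/
structure Diagram (κ : Type) : Type where
  word : Word κ
  closed : word.run 0 = some 0

/-- All crossings are resolved. -/
abbrev LinkDiagram : Type := Diagram Bool

/-- Some crossings may be unresolved. -/
abbrev LinkPseudodiagram : Type := Diagram (Option Bool)

theorem Word.run_map {κ κ' : Type} (f : κ → κ') (w : Word κ) (m : ℕ) :
    (w.map f).run m = w.run m := by
  induction w generalizing m with
  | nil => rfl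
  | cons s w ih =>
    obtain ⟨i, p⟩ := s
    have h : (p.map f).inn = p.inn ∧ (p.map f).out = p.out := by
      cases p <;> exact ⟨rfl, rfl⟩
    change (if i + (p.map f).inn ≤ m then
      (Word.map f w).run (m - (p.map f).inn + (p.map f).out) else none) = _
    rw [h.1, h.2, ih]
    rfl

def Diagram.map {κ κ' : Type} (f : κ → κ') (D : Diagram κ) : Diagram κ' :=
  ⟨D.word.map f, by rw [Word.run_map]; exact D.closed⟩

/-- The shadow of a link diagram: forget all over/under information. -/
def LinkDiagram.shadow (D : LinkDiagram) : LinkPseudodiagram :=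
  Diagram.map (fun _ => none) D

/-- A link diagram regarded as a pseudodiagram all of whose crossings are resolved. -/
def LinkDiagram.toPseudo (D : LinkDiagram) : LinkPseudodiagram :=
  Diagram.map some D

/-! ### Components -/

/-- Two points on consecutive (or equal) levels of a word lie on the same arc.  The point `(l, p)`
is the `p`-th strand, counted from the left, below the first `l` slices. -/
inductive Word.Joined {κ : Type} (w : Word κ) : ℕ × ℕ → ℕ × ℕ → Prop
  | left {l i p : ℕ} {g : Piece κ} : w[l]? = some ⟨i, g⟩ → p < i →
      Word.Joined w (l, p) (l + 1, p)
  | right {l i : ℕ} {g : Piece κ} (k : ℕ) : w[l]? = some ⟨i, g⟩ →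
      Word.Joined w (l, i + g.inn + k) (l + 1, i + g.out + k)
  | cap {l i : ℕ} : w[l]? = some ⟨i, .cap⟩ → Word.Joined w (l + 1, i) (l + 1, i + 1)
  | cup {l i : ℕ} : w[l]? = some ⟨i, .cup⟩ → Word.Joined w (l, i) (l, i + 1)
  | crossDown {l i : ℕ} {c : κ} : w[l]? = some ⟨i, .cross c⟩ →
      Word.Joined w (l, i) (l + 1, i + 1)
  | crossUp {l i : ℕ} {c : κ} : w[l]? = some ⟨i, .cross c⟩ →
      Word.Joined w (l, i + 1) (l + 1, i)

/-- The points of the diagram on the levels between consecutive slices. -/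
def Diagram.Point {κ : Type} (D : Diagram κ) : Type :=
  {x : ℕ × ℕ // ∃ m, Word.run 0 (D.word.take x.1) = some m ∧ x.2 < m}

/-- The components: classes of points under the equivalence relation generated by `Joined`. -/
def Diagram.Component {κ : Type} (D : Diagram κ) : Type :=
  Quot (fun x y : D.Point => D.word.Joined x.1 y.1)

noncomputable def Diagram.numComponents {κ : Type} (D : Diagram κ) : ℕ :=
  Nat.card D.Component

/-! ### Equivalence of link diagrams -/

/-- The local moves: interchange, zigzags and swings generate the planar isotopies, the others are the
Reidemeister moves. -/
inductive Move : Word Bool → Word Bool → Prop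
  /-- Exchange the heights of two pieces lying side by side, `s` on the left of `t`. -/
  | interchange (s t : Piece Bool) (i k : ℕ) :
      Move [⟨i, s⟩, ⟨i + s.out + k, t⟩] [⟨i + s.inn + k, t⟩, ⟨i, s⟩]
  /-- Straighten a zigzag. -/
  | zigzagLeft (i : ℕ) : Move [⟨i, .cap⟩, ⟨i + 1, .cup⟩] []
  | zigzagRight (i : ℕ) : Move [⟨i + 1, .cap⟩, ⟨i, .cup⟩] []
  /-- Move a strand from one side of a local minimum to the other. -/
  | swingCup (i : ℕ) (b : Bool) :
      Move [⟨i, .cross b⟩, ⟨i + 1, .cup⟩] [⟨i + 1, .cross (!b)⟩, ⟨i, .cup⟩]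
  /-- Move a strand from one side of a local maximum to the other. -/
  | swingCap (i : ℕ) (b : Bool) :
      Move [⟨i + 1, .cap⟩, ⟨i, .cross b⟩] [⟨i, .cap⟩, ⟨i + 1, .cross (!b)⟩]
  | R1Cap (i : ℕ) (b : Bool) : Move [⟨i, .cap⟩, ⟨i, .cross b⟩] [⟨i, .cap⟩]
  | R1Cup (i : ℕ) (b : Bool) : Move [⟨i, .cross b⟩, ⟨i, .cup⟩] [⟨i, .cup⟩]
  | R2 (i : ℕ) (b : Bool) : Move [⟨i, .cross b⟩, ⟨i, .cross (!b)⟩] []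
  /-- Only the case `a = c ≠ b`, where no strand lies above or below both others, is not a
  Reidemeister move. -/
  | R3 (i : ℕ) (a b c : Bool) : a = b ∨ b = c →
      Move [⟨i, .cross a⟩, ⟨i + 1, .cross b⟩, ⟨i, .cross c⟩]
        [⟨i + 1, .cross c⟩, ⟨i, .cross b⟩, ⟨i + 1, .cross a⟩]

/-- Apply a local move inside a link diagram. -/
def LinkDiagram.Step (D D' : LinkDiagram) : Prop :=
  ∃ A B L R : Word Bool, Move L R ∧ D.word = A ++ L ++ B ∧ D'.word = A ++ R ++ B

/-- A finite sequence of planar isotopies and Reidemeister moves leads from `D` to `D'`. -/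
def LinkDiagram.Equivalent (D D' : LinkDiagram) : Prop :=
  Relation.EqvGen LinkDiagram.Step D D'

/-- A split diagram: inside a circle, which meets no strand, there is a non-empty link diagram `E`,
and what remains outside is a non-empty link diagram too. -/
def LinkDiagram.IsSplit (D : LinkDiagram) : Prop :=
  ∃ (E O : LinkDiagram) (A B : Word Bool) (k : ℕ), E.word ≠ [] ∧ O.word ≠ [] ∧
    O.word = A ++ B ∧ D.word = A ++ E.word.shift k ++ B

def LinkDiagram.Splittable (D : LinkDiagram) : Prop :=
  ∃ D' : LinkDiagram, D.Equivalent D' ∧ D'.IsSplit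

/-! ### Rational tangles and their closures -/

/-- Twist the two bottom endpoints once. -/
def bottomTwist {κ : Type} (c : κ) (T : Word κ) : Word κ :=
  T ++ [⟨0, .cross c⟩]

/-- Twist the two right endpoints once: a crossing is drawn to the right of the tangle, its two left
ends are joined to the old right endpoints of the tangle and its two right ends are the new ones. -/
def rightTwist {κ : Type} (c : κ) (T : Word κ) : Word κ :=
  [⟨1, .cap⟩] ++ T ++ [⟨2, .cross c⟩, ⟨1, .cup⟩]

/-- Perform `k` twists of the two bottom (if `bottom`) or right endpoints. -/
def twists {κ : Type} (bottom : Bool) (c : κ) : ℕ → Word κ → Word κ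
  | 0, T => T
  | k + 1, T => (if bottom then bottomTwist c else rightTwist c) (twists bottom c k T)

/-- Read the syllables from left to right, alternating between bottom and right twists; the
overstrand has positive slope exactly for the crossings of positive syllables. -/
def addSyllables : Bool → List ℤ → Word Bool → Word Bool
  | _, [], T => T
  | bottom, a :: as, T =>
      addSyllables (!bottom) as (twists bottom (decide (0 < a)) a.natAbs T)

/-- The rational tangle with the given word; it starts from two parallel vertical strands. -/
def rationalTangle (a : List ℤ) : Word Bool := addSyllables true a []

/-- Join the two top endpoints of a tangle and its two bottom endpoints. -/
def numeratorWord {κ : Type} (T : Word κ) : Word κ :=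
  [⟨0, .cap⟩] ++ T ++ [⟨0, .cup⟩]

/-- Join the two left endpoints of a tangle and its two right endpoints. -/
def denominatorWord {κ : Type} (T : Word κ) : Word κ :=
  [⟨0, .cap⟩, ⟨2, .cap⟩] ++ T.shift 1 ++ [⟨0, .cup⟩, ⟨0, .cup⟩]

theorem Word.run_append {κ : Type} (v w : Word κ) (m : ℕ) :
    Word.run m (v ++ w) = (Word.run m v).bind (fun n => Word.run n w) := by
  induction v generalizing m with
  | nil => rfl
  | cons s v ih =>
    simp only [List.cons_append, Word.run]
    split
    · exact ih _
    · rfl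

/-- Additional strands on the left and on the right do not matter. -/
theorem Word.run_shift {κ : Type} (k r : ℕ) (w : Word κ) (m n : ℕ) (h : w.run m = some n) :
    (w.shift k).run (k + m + r) = some (k + n + r) := by
  induction w generalizing m with
  | nil =>
    simp only [Word.run, Option.some.injEq] at h
    simp [Word.shift, Word.run, h]
  | cons s w ih =>
    simp only [Word.run] at h
    split at h
    · rename_i hs
      have := ih _ h
      simp only [Word.shift, List.map_cons, Word.run] at this ⊢
      rw [if_pos (by omega), ← this]
      congr 1
      omega
    · simp at h

theorem Word.run_add {κ : Type} (r : ℕ) (w : Word κ) (m n : ℕ) (h : w.run m = some n) :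
    w.run (m + r) = some (n + r) := by
  have := Word.run_shift 0 r w m n h
  simpa [Word.shift] using this

theorem run_twists {κ : Type} (bottom : Bool) (c : κ) (k : ℕ) (T : Word κ)
    (h : T.run 2 = some 2) : (twists bottom c k T).run 2 = some 2 := by
  induction k with
  | zero => exact h
  | succ k ih =>
    have ih' := Word.run_add 2 _ _ _ ih
    cases bottom <;>
      simp_all [twists, bottomTwist, rightTwist, Word.run_append, Word.run, Piece.inn, Piece.out]

theorem run_addSyllables (bottom : Bool) (a : List ℤ) (T : Word Bool)
    (h : T.run 2 = some 2) : (addSyllables bottom a T).run 2 = some 2 := by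
  induction a generalizing bottom T with
  | nil => exact h
  | cons a as ih => exact ih _ _ (run_twists _ _ _ _ h)

theorem run_rationalTangle (a : List ℤ) : (rationalTangle a).run 2 = some 2 :=
  run_addSyllables true a [] rfl

/-- The two closures. -/
inductive Closure : Type
  | numerator : Closure
  | denominator : Closure

/-- The diagram of a closure of the rational tangle with the given word. -/
def rationalLink : Closure → List ℤ → LinkDiagram
  | .numerator, a => ⟨numeratorWord (rationalTangle a), by
      simp [numeratorWord, Word.run_append, Word.run, Piece.inn, Piece.out, run_rationalTangle]⟩
  | .denominator, a => ⟨denominatorWord (rationalTangle a), by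
      have h := Word.run_shift 1 1 _ _ _ (run_rationalTangle a)
      simp only [Nat.reduceAdd] at h
      simp [denominatorWord, Word.run_append, Word.run, Piece.inn, Piece.out, h]⟩

/-! ### The game -/

/-- A move of the game: resolve one unresolved crossing, in one of the two ways. -/
def LinkPseudodiagram.Resolves (P Q : LinkPseudodiagram) : Prop :=
  ∃ (A B : Word (Option Bool)) (i : ℕ) (b : Bool),
    P.word = A ++ [⟨i, .cross none⟩] ++ B ∧ Q.word = A ++ [⟨i, .cross (some b)⟩] ++ B

/-- `HasWinningStrategy W t P`: in the game played from the position `P`, with the two players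
resolving crossings in turn until a link diagram is reached, a player who wins exactly if the final
diagram satisfies `W` can force a win.  This player moves next if `t = true`, and the opponent moves
next if `t = false`. -/
inductive HasWinningStrategy (W : LinkDiagram → Prop) : Bool → LinkPseudodiagram → Prop
  | finished {t : Bool} {P : LinkPseudodiagram} (D : LinkDiagram) :
      P = D.toPseudo → W D → HasWinningStrategy W t P
  | ownMove {P : LinkPseudodiagram} (Q : LinkPseudodiagram) :
      P.Resolves Q → HasWinningStrategy W false Q → HasWinningStrategy W true P
  | opponentMove {P : LinkPseudodiagram} :
      (∃ Q : LinkPseudodiagram, P.Resolves Q) →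
      (∀ Q : LinkPseudodiagram, P.Resolves Q → HasWinningStrategy W true Q) →
      HasWinningStrategy W false P

inductive Role : Type
  | linker : Role
  | unlinker : Role

/-- The player with the given role wins if the game ends with the diagram `D`. -/
def Role.Wins : Role → LinkDiagram → Prop
  | .linker, D => ¬ D.Splittable
  | .unlinker, D => D.Splittable

/-- In the Linking-Unlinking Game on the shadow `P`, the second player has a winning strategy when
playing the given role. -/
def SecondPlayerHasWinningStrategy (r : Role) (P : LinkPseudodiagram) : Prop :=
  HasWinningStrategy r.Wins false P

end LinkGame

/-! Let the tangle have its crossings in the order of the twists. The first twist turns two vertical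
arcs into two arcs running diagonally. As $a_1$ and $a_n$ are odd and the other syllables even, the
twists strictly between the first and the last one come in consecutive pairs of the same kind, and
each pair restores the diagonal connection. The last twist makes the arcs vertical or horizontal.
Exactly one closure then has two components, namely the one in which each arc closes up separately.
Every crossing involves both arcs, and with the arcs oriented, slope and sign of a crossing agree at
all crossings or disagree at all of them. Hence the signs, whose sum is twice the linking number,
add up to plus or minus the sum of the slopes.

The number of crossings is even, so the second player moves last. As Linker, this player only has to
make the sum of the slopes non-zero with the last move (`exists_unit_add_ne_zero`), because a
non-zero linking number obstructs splitting (`not_splittable_of_total_ne_zero`). As Unlinker, this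
player pairs the first crossing with the last one and the others consecutively, and always answers
at the partner with the opposite slope. Consecutive pairs then cancel by Reidemeister II
(`twistAlong_paired_cancel`), after which the first and the last crossing cancel too and two
disjoint circles remain (`splittable_of_paired`).

Linking numbers are treated without choosing components. `Labelled` says that the strands of a word
can be oriented and colored consistently with sign sum `z` and set of colors `U`. Which pairs `(z,
U)` occur is invariant under all moves, and a split diagram has a two-colored labelling with sum
zero. The same formalism with colors alone (`plain`) turns the hypothesis of two components into a
statement about the closure. -/

namespace LinkGame

/-! ### Labellings of words and their behaviour under composition -/

/-- Labels for the strands of a word, with the label `bar x` for a strand labelled `x` that is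
traversed in the opposite direction, and with a sign for each crossing of labelled strands. -/
structure LabelSystem where
  Label : Type
  bar : Label → Label
  color : Label → Bool
  sign : Bool → Label → Label → ℤ
  bar_bar : ∀ x, bar (bar x) = x
  color_bar : ∀ x, color (bar x) = color x
  sign_comm : ∀ b x y, sign b x y = sign b y x
  sign_not : ∀ b x y, sign (!b) x y = -sign b x y
  sign_bar : ∀ b x y, sign b x (bar y) = -sign b x y
  sign_eq_zero : ∀ b x y, color x = color y → sign b x y = 0

namespace LabelSystem

variable (S : LabelSystem)

def colors (s : List S.Label) : Finset Bool := (s.map S.color).toFinset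

@[simp] theorem colors_nil : S.colors [] = ∅ := rfl

@[simp] theorem colors_cons (x : S.Label) (s : List S.Label) :
    S.colors (x :: s) = insert (S.color x) (S.colors s) := by
  simp [colors]

@[simp] theorem colors_append (s t : List S.Label) :
    S.colors (s ++ t) = S.colors s ∪ S.colors t := by
  simp [colors]

/-- The strands labelled `s` above a slice continue as the strands labelled `t` below it, and the
crossing in the slice has sign `z`. -/
def Pass : ℕ → Piece Bool → List S.Label → List S.Label → ℤ → Prop
  | 0, .cap, s, t, z => z = 0 ∧ ∃ x, t = x :: S.bar x :: s
  | 0, .cup, s, t, z => z = 0 ∧ ∃ x, s = x :: S.bar x :: t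
  | 0, .cross b, s, t, z => ∃ x y r, s = x :: y :: r ∧ t = y :: x :: r ∧ z = S.sign b x y
  | i + 1, g, s, t, z => ∃ x s' t', s = x :: s' ∧ t = x :: t' ∧ Pass i g s' t' z

/-- The word has a labelling with labels `s` at the top and `t` at the bottom, for which the signs
add up to `z` and `U` is the set of all colors that occur. -/
def Labelled : Word Bool → List S.Label → List S.Label → ℤ → Finset Bool → Prop
  | [], s, t, z, U => t = s ∧ z = 0 ∧ U = S.colors s
  | c :: w, s, t, z, U => ∃ r z₁ z₂ V, S.Pass c.pos c.piece s r z₁ ∧ Labelled w r t z₂ V ∧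
      z = z₁ + z₂ ∧ U = S.colors s ∪ V

variable {S}

theorem Pass.length {i : ℕ} {g : Piece Bool} {s t : List S.Label} {z : ℤ}
    (h : S.Pass i g s t z) :
    i + g.inn ≤ s.length ∧ t.length = s.length - g.inn + g.out := by
  induction i generalizing s t with
  | zero =>
    cases g with
    | cap => obtain ⟨-, x, rfl⟩ := h; simp [Piece.inn, Piece.out]
    | cup => obtain ⟨-, x, rfl⟩ := h; simp [Piece.inn, Piece.out]
    | cross b => obtain ⟨x, y, r, rfl, rfl, -⟩ := h; simp [Piece.inn, Piece.out]
  | succ i ih =>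
    obtain ⟨x, s', t', rfl, rfl, h⟩ := h
    have := ih h
    simp only [List.length_cons]
    omega

theorem Labelled.run {w : Word Bool} {s t : List S.Label} {z : ℤ} {U : Finset Bool}
    (h : S.Labelled w s t z U) : w.run s.length = some t.length := by
  induction w generalizing s z U with
  | nil => obtain ⟨rfl, -⟩ := h; rfl
  | cons c w ih =>
    obtain ⟨r, z₁, z₂, V, h1, h2, -⟩ := h
    have h3 := h1.length
    rw [Word.run, if_pos h3.1, ← h3.2]
    exact ih h2

theorem Labelled.colors_subset {w : Word Bool} {s t : List S.Label} {z : ℤ} {U : Finset Bool}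
    (h : S.Labelled w s t z U) : S.colors s ⊆ U := by
  cases w with
  | nil => obtain ⟨-, -, rfl⟩ := h; rfl
  | cons c w =>
    obtain ⟨r, z₁, z₂, V, -, -, -, rfl⟩ := h
    exact Finset.subset_union_left

/-- The level between the two words is counted in both color sets, which does no harm to a union.
For the same reason the empty word has the colors of its strands and not the empty set. -/
theorem labelled_append {v w : Word Bool} {s t : List S.Label} {z : ℤ} {U : Finset Bool} :
    S.Labelled (v ++ w) s t z U ↔ ∃ r z₁ z₂ V W, S.Labelled v s r z₁ V ∧
      S.Labelled w r t z₂ W ∧ z = z₁ + z₂ ∧ U = V ∪ W := by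
  induction v generalizing s z U with
  | nil =>
    constructor
    · intro h
      refine ⟨s, 0, z, S.colors s, U, ⟨rfl, rfl, rfl⟩, h, by simp, ?_⟩
      rw [Finset.union_eq_right.2 h.colors_subset]
    · rintro ⟨r, z₁, z₂, V, W, ⟨rfl, rfl, rfl⟩, h, rfl, rfl⟩
      rw [Finset.union_eq_right.2 h.colors_subset]
      simpa using h
  | cons c v ih =>
    constructor
    · rintro ⟨r, z₁, z₂, V, h1, h2, rfl, rfl⟩
      obtain ⟨r', z₃, z₄, V', W, h3, h4, rfl, rfl⟩ := ih.1 h2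
      exact ⟨r', z₁ + z₃, z₄, S.colors s ∪ V', W, ⟨r, z₁, z₃, V', h1, h3, rfl, rfl⟩, h4,
        by ring, by rw [Finset.union_assoc]⟩
    · rintro ⟨r', z₁, z₂, V, W, ⟨r, z₃, z₄, V', h1, h3, rfl, rfl⟩, h4, rfl, rfl⟩
      exact ⟨r, z₃, z₄ + z₂, V' ∪ W, h1, ih.2 ⟨r', z₄, z₂, V', W, h3, h4, rfl, rfl⟩,
        by ring, by rw [Finset.union_assoc]⟩

theorem labelled_shift_one {w : Word Bool} {x : S.Label} {s t : List S.Label} {z : ℤ}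
    {U : Finset Bool} :
    S.Labelled (w.shift 1) (x :: s) t z U ↔ ∃ t' V, t = x :: t' ∧ S.Labelled w s t' z V ∧
      U = insert (S.color x) V := by
  induction w generalizing s z U with
  | nil =>
    constructor
    · rintro ⟨rfl, rfl, rfl⟩
      exact ⟨s, _, rfl, ⟨rfl, rfl, rfl⟩, by simp⟩
    · rintro ⟨t', V, rfl, ⟨rfl, rfl, rfl⟩, rfl⟩
      exact ⟨rfl, rfl, by simp⟩
  | cons c w ih =>
    have hc : Word.shift 1 (c :: w) = ⟨c.pos + 1, c.piece⟩ :: Word.shift 1 w := by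
      simp [Word.shift, add_comm]
    rw [hc]
    constructor
    · rintro ⟨r, z₁, z₂, V, ⟨x', s', r', h1, rfl, h2⟩, h3, rfl, rfl⟩
      obtain ⟨rfl, rfl⟩ := List.cons.inj h1
      obtain ⟨t', V', rfl, h4, rfl⟩ := ih.1 h3
      refine ⟨t', S.colors s ∪ V', rfl, ⟨r', z₁, z₂, V', h2, h4, rfl, rfl⟩, ?_⟩
      ext c; simp
    · rintro ⟨t', V, rfl, ⟨r', z₁, z₂, V', h2, h4, rfl, rfl⟩, rfl⟩
      refine ⟨x :: r', z₁, z₂, insert (S.color x) V', ⟨x, s, r', rfl, rfl, h2⟩,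
        ih.2 ⟨t', V', rfl, h4, rfl⟩, rfl, ?_⟩
      ext c; simp

theorem labelled_shift {w : Word Bool} {r s t : List S.Label} {z : ℤ} {U : Finset Bool} :
    S.Labelled (w.shift r.length) (r ++ s) t z U ↔ ∃ t' V, t = r ++ t' ∧ S.Labelled w s t' z V ∧
      U = S.colors r ∪ V := by
  induction r generalizing t U with
  | nil => simp [Word.shift]
  | cons x r ih =>
    have hc : Word.shift (x :: r).length w = Word.shift 1 (Word.shift r.length w) := by
      simp only [Word.shift, List.length_cons, List.map_map, List.map_inj_left, Function.comp_apply,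
        Slice.mk.injEq, and_true]
      intros; omega
    rw [hc, List.cons_append, labelled_shift_one]
    simp only [ih]
    constructor
    · rintro ⟨_, _, rfl, ⟨t', V, rfl, h, rfl⟩, rfl⟩
      exact ⟨t', V, rfl, h, by simp⟩
    · rintro ⟨t', V, rfl, h, rfl⟩
      exact ⟨_, _, rfl, ⟨t', V, rfl, h, rfl⟩, by simp⟩

theorem pass_append {i : ℕ} {g : Piece Bool} {s r t : List S.Label} {z : ℤ}
    (h : i + g.inn ≤ s.length) :
    S.Pass i g (s ++ r) t z ↔ ∃ t', t = t' ++ r ∧ S.Pass i g s t' z := by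
  induction i generalizing s t with
  | zero =>
    cases g with
    | cap =>
      constructor
      · rintro ⟨rfl, x, rfl⟩; exact ⟨_, rfl, rfl, x, rfl⟩
      · rintro ⟨t', rfl, rfl, x, rfl⟩; exact ⟨rfl, x, rfl⟩
    | cup =>
      match s with
      | [] | [_] => simp [Piece.inn] at h
      | x :: y :: s =>
        constructor
        · rintro ⟨rfl, x', h⟩
          simp only [List.cons_append, List.cons.injEq] at h
          obtain ⟨rfl, rfl, rfl⟩ := h
          exact ⟨s, rfl, rfl, x, rfl⟩
        · rintro ⟨t', rfl, rfl, x', h⟩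
          simp only [List.cons.injEq] at h
          obtain ⟨rfl, rfl, rfl⟩ := h
          exact ⟨rfl, x, rfl⟩
    | cross b =>
      match s with
      | [] | [_] => simp [Piece.inn] at h
      | x :: y :: s =>
        constructor
        · rintro ⟨x', y', r', h, rfl, rfl⟩
          simp only [List.cons_append, List.cons.injEq] at h
          obtain ⟨rfl, rfl, rfl⟩ := h
          exact ⟨_, rfl, x, y, s, rfl, rfl, rfl⟩
        · rintro ⟨t', rfl, x', y', r', h, rfl, rfl⟩
          simp only [List.cons.injEq] at h
          obtain ⟨rfl, rfl, rfl⟩ := h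
          exact ⟨x, y, _, rfl, rfl, rfl⟩
  | succ i ih =>
    match s with
    | [] => simp at h
    | x :: s =>
      have h' : i + g.inn ≤ s.length := by simp only [List.length_cons] at h; omega
      constructor
      · rintro ⟨x', s', t', h1, rfl, h2⟩
        obtain ⟨rfl, rfl⟩ := List.cons.inj h1
        obtain ⟨t'', rfl, h3⟩ := (ih h').1 h2
        exact ⟨x :: t'', rfl, x, s, t'', rfl, rfl, h3⟩
      · rintro ⟨_, rfl, x', s', t', h1, rfl, h2⟩
        obtain ⟨rfl, rfl⟩ := List.cons.inj h1
        exact ⟨x, s ++ r, t' ++ r, rfl, rfl, (ih h').2 ⟨t', rfl, h2⟩⟩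

/-- Additional strands on the right do not matter. -/
theorem labelled_add {w : Word Bool} {s r t : List S.Label} {z : ℤ} {U : Finset Bool} {n : ℕ}
    (h : w.run s.length = some n) :
    S.Labelled w (s ++ r) t z U ↔ ∃ t' V, t = t' ++ r ∧ S.Labelled w s t' z V ∧
      U = V ∪ S.colors r := by
  induction w generalizing s z U with
  | nil =>
    constructor
    · rintro ⟨rfl, rfl, rfl⟩
      exact ⟨s, _, rfl, ⟨rfl, rfl, rfl⟩, by simp⟩
    · rintro ⟨t', V, rfl, ⟨rfl, rfl, rfl⟩, rfl⟩
      exact ⟨rfl, rfl, by simp⟩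
  | cons c w ih =>
    rw [Word.run] at h
    split at h
    · rename_i hc
      constructor
      · rintro ⟨_, z₁, z₂, V, h1, h2, rfl, rfl⟩
        obtain ⟨s', rfl, h3⟩ := (pass_append hc).1 h1
        rw [← h3.length.2] at h
        obtain ⟨t', V', rfl, h4, rfl⟩ := (ih h).1 h2
        refine ⟨t', S.colors s ∪ V', rfl, ⟨s', z₁, z₂, V', h3, h4, rfl, rfl⟩, ?_⟩
        ext c; simp; tauto
      · rintro ⟨t', V, rfl, ⟨s', z₁, z₂, V', h3, h4, rfl, rfl⟩, rfl⟩
        rw [← h3.length.2] at h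
        refine ⟨s' ++ r, z₁, z₂, _, (pass_append hc).2 ⟨s', rfl, h3⟩,
          (ih h).2 ⟨t', V', rfl, h4, rfl⟩, rfl, ?_⟩
        ext c; simp; tauto
    · simp at h

end LabelSystem
end LinkGame

/-! ### Invariance of labellings under planar isotopies and Reidemeister moves -/

namespace LinkGame

/-- The first slice of a shifted word needs `k` strands on its left. An empty word needs none, so it
has to be excluded. -/
theorem Word.run_of_shift {κ : Type} {k m n : ℕ} {w : Word κ} (hw : w ≠ [])
    (h : (w.shift k).run m = some n) : k ≤ m ∧ ∃ n', w.run (m - k) = some n' := by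
  induction w generalizing m with
  | nil => exact absurd rfl hw
  | cons c w ih =>
    have hc : Word.shift k (c :: w) = ⟨k + c.pos, c.piece⟩ :: Word.shift k w := rfl
    rw [hc, Word.run] at h
    split at h
    · rename_i hk
      dsimp only at hk h
      refine ⟨by omega, ?_⟩
      rw [Word.run, if_pos (by omega)]
      rcases eq_or_ne w [] with rfl | hw'
      · exact ⟨_, rfl⟩
      · obtain ⟨n', hn'⟩ := (ih hw' h).2
        exact ⟨n', by rw [← hn']; congr 1; omega⟩
    · simp at h

/-- The local moves with nothing on the left. -/
inductive BaseMove : Word Bool → Word Bool → Prop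
  | interchange (s t : Piece Bool) (k : ℕ) :
      BaseMove [⟨0, s⟩, ⟨s.out + k, t⟩] [⟨s.inn + k, t⟩, ⟨0, s⟩]
  | zigzagLeft : BaseMove [⟨0, .cap⟩, ⟨1, .cup⟩] []
  | zigzagRight : BaseMove [⟨1, .cap⟩, ⟨0, .cup⟩] []
  | swingCup (b : Bool) :
      BaseMove [⟨0, .cross b⟩, ⟨1, .cup⟩] [⟨1, .cross (!b)⟩, ⟨0, .cup⟩]
  | swingCap (b : Bool) :
      BaseMove [⟨1, .cap⟩, ⟨0, .cross b⟩] [⟨0, .cap⟩, ⟨1, .cross (!b)⟩]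
  | R1Cap (b : Bool) : BaseMove [⟨0, .cap⟩, ⟨0, .cross b⟩] [⟨0, .cap⟩]
  | R1Cup (b : Bool) : BaseMove [⟨0, .cross b⟩, ⟨0, .cup⟩] [⟨0, .cup⟩]
  | R2 (b : Bool) : BaseMove [⟨0, .cross b⟩, ⟨0, .cross (!b)⟩] []
  | R3 (a b c : Bool) :
      BaseMove [⟨0, .cross a⟩, ⟨1, .cross b⟩, ⟨0, .cross c⟩]
        [⟨1, .cross c⟩, ⟨0, .cross b⟩, ⟨1, .cross a⟩]

theorem Move.exists_shift {L R : Word Bool} (h : Move L R) :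
    ∃ k L' R', BaseMove L' R' ∧ L = L'.shift k ∧ R = R'.shift k := by
  cases h with
  | interchange s t i k =>
    exact ⟨i, _, _, .interchange s t k, by simp [Word.shift, add_assoc],
      by simp [Word.shift, add_assoc]⟩
  | zigzagLeft i => exact ⟨i, _, _, .zigzagLeft, rfl, rfl⟩
  | zigzagRight i => exact ⟨i, _, _, .zigzagRight, rfl, rfl⟩
  | swingCup i b => exact ⟨i, _, _, .swingCup b, rfl, rfl⟩
  | swingCap i b => exact ⟨i, _, _, .swingCap b, rfl, rfl⟩
  | R1Cap i b => exact ⟨i, _, _, .R1Cap b, rfl, rfl⟩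
  | R1Cup i b => exact ⟨i, _, _, .R1Cup b, rfl, rfl⟩
  | R2 i b => exact ⟨i, _, _, .R2 b, rfl, rfl⟩
  | R3 i a b c _ => exact ⟨i, _, _, .R3 a b c, rfl, rfl⟩

theorem BaseMove.ne_nil {L R : Word Bool} (h : BaseMove L R) : L ≠ [] := by
  cases h <;> simp

namespace LabelSystem

variable {S : LabelSystem}

theorem pass_zero_cap {s t : List S.Label} {z : ℤ} :
    S.Pass 0 .cap s t z ↔ z = 0 ∧ ∃ x, t = x :: S.bar x :: s := Iff.rfl

theorem pass_zero_cup {s t : List S.Label} {z : ℤ} :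
    S.Pass 0 .cup s t z ↔ z = 0 ∧ ∃ x, s = x :: S.bar x :: t := Iff.rfl

theorem pass_zero_cross {b : Bool} {s t : List S.Label} {z : ℤ} :
    S.Pass 0 (.cross b) s t z ↔
      ∃ x y r, s = x :: y :: r ∧ t = y :: x :: r ∧ z = S.sign b x y := Iff.rfl

theorem pass_succ {i : ℕ} {g : Piece Bool} {s t : List S.Label} {z : ℤ} :
    S.Pass (i + 1) g s t z ↔ ∃ x s' t', s = x :: s' ∧ t = x :: t' ∧ S.Pass i g s' t' z := Iff.rfl

theorem pass_one {g : Piece Bool} {s t : List S.Label} {z : ℤ} :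
    S.Pass 1 g s t z ↔ ∃ x s' t', s = x :: s' ∧ t = x :: t' ∧ S.Pass 0 g s' t' z := Iff.rfl

theorem pass_two {g : Piece Bool} {s t : List S.Label} {z : ℤ} :
    S.Pass 2 g s t z ↔ ∃ x s' t', s = x :: s' ∧ t = x :: t' ∧ S.Pass 1 g s' t' z := Iff.rfl

theorem labelled_nil {s t : List S.Label} {z : ℤ} {U : Finset Bool} :
    S.Labelled [] s t z U ↔ t = s ∧ z = 0 ∧ U = S.colors s := Iff.rfl

theorem labelled_cons {c : Slice Bool} {w : Word Bool} {s t : List S.Label} {z : ℤ}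
    {U : Finset Bool} :
    S.Labelled (c :: w) s t z U ↔ ∃ r z₁ z₂ V, S.Pass c.pos c.piece s r z₁ ∧
      S.Labelled w r t z₂ V ∧ z = z₁ + z₂ ∧ U = S.colors s ∪ V := Iff.rfl

theorem sign_bar_left (b : Bool) (x y : S.Label) : S.sign b (S.bar x) y = -S.sign b x y := by
  rw [S.sign_comm, S.sign_bar, S.sign_comm]

theorem sign_self (b : Bool) (x : S.Label) : S.sign b x x = 0 := S.sign_eq_zero b x x rfl

attribute [simp] pass_zero_cap pass_zero_cup pass_zero_cross pass_one pass_two labelled_nil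
  labelled_cons bar_bar color_bar sign_not sign_bar sign_bar_left sign_self Piece.inn Piece.out

theorem labelled_interchange (p g : Piece Bool) (k : ℕ) {s t : List S.Label} {z : ℤ}
    {U : Finset Bool} : S.Labelled [⟨0, p⟩, ⟨p.out + k, g⟩] s t z U ↔
      S.Labelled [⟨p.inn + k, g⟩, ⟨0, p⟩] s t z U := by
  cases p with
  | cap =>
    simp only [Piece.out, Piece.inn, add_comm 2 k, Nat.zero_add]
    constructor
    · simp [pass_succ]
      rintro x r h rfl rfl
      refine ⟨r, h, x, rfl, ?_⟩
      ext c; simp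
    · simp [pass_succ]
      rintro r h x rfl rfl
      refine ⟨x, r, ⟨h, rfl⟩, ?_⟩
      ext c; simp
  | cup =>
    simp only [Piece.out, Piece.inn, add_comm 2 k, Nat.zero_add]
    constructor
    · simp [pass_succ]
      rintro r x rfl h rfl
      refine ⟨x, ⟨r, rfl, h⟩, ?_⟩
      ext c; simp
    · simp [pass_succ]
      rintro x r rfl h rfl
      refine ⟨r, ⟨x, rfl⟩, h, ?_⟩
      ext c; simp
  | cross b =>
    simp only [Piece.out, Piece.inn, add_comm 2 k]
    constructor
    · simp [pass_succ]
      rintro x y s' rfl z₁ r h rfl rfl rfl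
      refine ⟨z₁, x, y, s', r, ⟨rfl, h⟩, rfl, by ring, ?_⟩
      ext c; simp
    · simp [pass_succ]
      rintro z₁ x y s' r rfl h rfl rfl rfl
      refine ⟨x, y, s', rfl, z₁, r, ⟨h, rfl⟩, by ring, ?_⟩
      ext c; simp

/-- The labels on one side determine those on the other. In R1 the loop is read in the opposite
direction and its crossing has sign zero, being of one color; in R2 the two signs cancel; in R3 the
same three pairs of strands cross with the same decorations, so that the condition on the
decorations plays no role. The hypothesis on `run` is needed when the right side is empty, since the
empty word accepts too few strands as well. -/
theorem _root_.LinkGame.BaseMove.labelled {L R : Word Bool} (h : BaseMove L R)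
    {s t : List S.Label} {z : ℤ} {U : Finset Bool} {n : ℕ} (hL : L.run s.length = some n) :
    S.Labelled L s t z U ↔ S.Labelled R s t z U := by
  cases h with
  | interchange p g k => exact labelled_interchange p g k
  | zigzagLeft =>
    simp [Word.run] at hL
    simp
    constructor
    · rintro ⟨x, r, ⟨rfl, rfl⟩, rfl, rfl⟩
      simp
    · rintro ⟨rfl, rfl, rfl⟩
      match t with
      | [] => simp at hL
      | x :: r => exact ⟨x, r, by simp⟩
  | zigzagRight =>
    simp [Word.run] at hL
    simp
    constructor
    · rintro ⟨x, s', rfl, rfl, rfl, rfl⟩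
      simp
    · rintro ⟨rfl, rfl, rfl⟩
      match t with
      | [] => simp at hL
      | x :: r => exact ⟨x, r, by simp⟩
  | R1Cap b =>
    simp
    constructor
    · rintro ⟨x, rfl, rfl, rfl⟩
      exact ⟨S.bar x, by simp⟩
    · rintro ⟨x, rfl, rfl, rfl⟩
      exact ⟨S.bar x, by simp⟩
  | R1Cup b =>
    simp
    constructor
    · rintro ⟨y, rfl, rfl, rfl⟩
      refine ⟨⟨S.bar y, by simp⟩, rfl, ?_⟩
      ext c; simp
    · rintro ⟨⟨x, rfl⟩, rfl, rfl⟩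
      refine ⟨S.bar x, by simp, rfl, ?_⟩
      ext c; simp
  | R2 b =>
    simp
    constructor
    · rintro ⟨x, y, r, rfl, rfl, rfl, rfl⟩
      refine ⟨rfl, by rw [S.sign_comm]; ring, ?_⟩
      ext c; simp
    · simp [Word.run] at hL
      rintro ⟨rfl, rfl, rfl⟩
      match t with
      | [] | [_] => simp at hL
      | x :: y :: r =>
        refine ⟨x, y, r, rfl, rfl, by rw [S.sign_comm]; ring, ?_⟩
        ext c; simp
  | swingCup b =>
    simp
    constructor
    · rintro ⟨x, y, r, rfl, rfl, rfl, rfl⟩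
      refine ⟨x, y, r, rfl, rfl, by rw [S.sign_comm], ?_⟩
      ext c; simp
    · rintro ⟨x, y, r, rfl, rfl, rfl, rfl⟩
      refine ⟨x, y, r, rfl, rfl, by rw [S.sign_comm], ?_⟩
      ext c; simp
  | swingCap b =>
    simp
    constructor
    · rintro ⟨y, r, rfl, x, rfl, rfl, rfl⟩
      exact ⟨x, y, r, ⟨rfl, rfl⟩, by rw [S.sign_comm], rfl⟩
    · rintro ⟨x, y, r, ⟨rfl, rfl⟩, rfl, rfl⟩
      exact ⟨y, r, rfl, x, rfl, by rw [S.sign_comm], rfl⟩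
  | R3 a b c =>
    simp
    constructor
    · rintro ⟨x, y, v, r, rfl, rfl, rfl, rfl⟩
      refine ⟨x, y, v, r, rfl, rfl, by ring, ?_⟩
      ext c; simp
    · rintro ⟨x, y, v, r, rfl, rfl, rfl, rfl⟩
      refine ⟨x, y, v, r, rfl, rfl, by ring, ?_⟩
      ext c; simp

theorem _root_.LinkGame.Move.labelled {L R : Word Bool} (h : Move L R)
    {s t : List S.Label} {z : ℤ} {U : Finset Bool} {n : ℕ} (hL : L.run s.length = some n) :
    S.Labelled L s t z U ↔ S.Labelled R s t z U := by
  obtain ⟨k, L', R', hb, rfl, rfl⟩ := h.exists_shift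
  obtain ⟨hk, n', hn⟩ := Word.run_of_shift hb.ne_nil hL
  obtain ⟨s₁, s₂, rfl, rfl⟩ : ∃ s₁ s₂, s = s₁ ++ s₂ ∧ s₁.length = k :=
    ⟨s.take k, s.drop k, by simp, by simpa using hk⟩
  have hn : L'.run s₂.length = some n' := by simpa using hn
  simp only [labelled_shift, hb.labelled hn]

/-- A labelling is cut at the two ends of the local move. Its part above guarantees that the left
side of the move is given as many strands as it needs. -/
theorem _root_.LinkGame.LinkDiagram.Step.labelled_iff {D D' : LinkDiagram} (h : D.Step D') {z : ℤ}
    {U : Finset Bool} : S.Labelled D.word [] [] z U ↔ S.Labelled D'.word [] [] z U := by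
  obtain ⟨A, B, L, R, hm, h1, h2⟩ := h
  have hD := D.closed
  rw [h1, h2]
  rw [h1] at hD
  simp only [labelled_append]
  have key : ∀ s t z U y V, S.Labelled A [] s y V →
      (S.Labelled L s t z U ↔ S.Labelled R s t z U) := by
    intro s t z U y V hA
    have := hA.run
    rw [Word.run_append, Word.run_append] at hD
    simp only [List.length_nil] at this
    rw [this] at hD
    cases hn : L.run s.length with
    | none => simp [hn] at hD
    | some n => exact hm.labelled hn
  constructor
  · rintro ⟨r, z₁, z₂, V, W, ⟨r', z₃, z₄, V', W', h3, h4, rfl, rfl⟩, h5, rfl, rfl⟩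
    exact ⟨_, _, _, _, _, ⟨_, _, _, _, _, h3, (key _ _ _ _ _ _ h3).1 h4, rfl, rfl⟩, h5, rfl, rfl⟩
  · rintro ⟨r, z₁, z₂, V, W, ⟨r', z₃, z₄, V', W', h3, h4, rfl, rfl⟩, h5, rfl, rfl⟩
    exact ⟨_, _, _, _, _, ⟨_, _, _, _, _, h3, (key _ _ _ _ _ _ h3).2 h4, rfl, rfl⟩, h5, rfl, rfl⟩

theorem _root_.LinkGame.LinkDiagram.Equivalent.labelled_iff {D D' : LinkDiagram}
    (h : D.Equivalent D') {z : ℤ} {U : Finset Bool} :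
    S.Labelled D.word [] [] z U ↔ S.Labelled D'.word [] [] z U := by
  induction h with
  | rel _ _ h => exact h.labelled_iff
  | refl => rfl
  | symm _ _ _ ih => exact ih.symm
  | trans _ _ _ _ _ ih₁ ih₂ => exact ih₁.trans ih₂

end LabelSystem
end LinkGame

/-! ### The linking number as an obstruction to splitting -/

namespace LinkGame

namespace LabelSystem

/-- A label consists of a color and of an orientation. -/
def oriented : LabelSystem where
  Label := Bool × Bool
  bar x := (x.1, !x.2)
  color x := x.1
  -- If both strands run downwards or both run upwards, the crossing is positive exactly if the
  -- overstrand has positive slope; reversing one strand reverses the sign. Crossings within one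
  -- color do not contribute.
  sign b x y := if x.1 = y.1 then 0 else if b = (x.2 == y.2) then 1 else -1
  bar_bar := by decide
  color_bar := by decide
  sign_comm := by decide
  sign_not := by decide
  sign_bar := by decide
  sign_eq_zero := by decide

/-- A label is a color. -/
def plain : LabelSystem where
  Label := Bool
  bar x := x
  color x := x
  sign _ _ _ := 0
  bar_bar := by decide
  color_bar := by decide
  sign_comm := by decide
  sign_not := by decide
  sign_bar := by decide
  sign_eq_zero := by decide

/-- Give a label the color `c`. -/
def recolor (c : Bool) (x : oriented.Label) : oriented.Label := (c, x.2)

theorem Pass.recolor (c : Bool) {i : ℕ} {g : Piece Bool} {s t : List oriented.Label} {z : ℤ}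
    (h : oriented.Pass i g s t z) :
    oriented.Pass i g (s.map (recolor c)) (t.map (recolor c)) 0 := by
  induction i generalizing s t with
  | zero =>
    cases g with
    | cap => obtain ⟨-, x, rfl⟩ := h; exact ⟨rfl, LabelSystem.recolor c x, rfl⟩
    | cup => obtain ⟨-, x, rfl⟩ := h; exact ⟨rfl, LabelSystem.recolor c x, rfl⟩
    | cross b =>
      obtain ⟨x, y, r, rfl, rfl, -⟩ := h
      exact ⟨_, _, _, rfl, rfl, (oriented.sign_eq_zero b (LabelSystem.recolor c x)
        (LabelSystem.recolor c y) rfl).symm⟩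
  | succ i ih =>
    obtain ⟨x, s', t', rfl, rfl, h⟩ := h
    exact ⟨_, _, _, rfl, rfl, ih h⟩

theorem colors_map_recolor (c : Bool) (s : List oriented.Label) :
    oriented.colors (s.map (recolor c)) = (oriented.colors s).image (fun _ => c) := by
  induction s with
  | nil => rfl
  | cons x s ih => rw [List.map_cons, colors_cons, colors_cons, ih, Finset.image_insert]; rfl

theorem Labelled.recolor (c : Bool) {w : Word Bool} {s t : List oriented.Label} {z : ℤ}
    {U : Finset Bool} (h : oriented.Labelled w s t z U) :
    oriented.Labelled w (s.map (recolor c)) (t.map (recolor c)) 0 (U.image (fun _ => c)) := by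
  induction w generalizing s z U with
  | nil =>
    obtain ⟨rfl, rfl, rfl⟩ := h
    exact ⟨rfl, rfl, (colors_map_recolor c _).symm⟩
  | cons d w ih =>
    obtain ⟨r, z₁, z₂, V, h1, h2, rfl, rfl⟩ := h
    exact ⟨_, 0, 0, _, h1.recolor c, ih h2, rfl, by rw [Finset.image_union, colors_map_recolor]⟩

theorem Labelled.nonempty {S : LabelSystem} {w : Word Bool} {t : List S.Label} {z : ℤ}
    {U : Finset Bool} (h : S.Labelled w [] t z U) (hw : w ≠ []) : U.Nonempty := by
  match w with
  | [] => exact absurd rfl hw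
  | c :: w =>
    obtain ⟨r, z₁, z₂, V, h1, h2, rfl, rfl⟩ := h
    have h3 := h1.length
    have : r ≠ [] := by
      rintro rfl
      obtain ⟨i, g⟩ := c
      cases g <;> simp at h3
    obtain ⟨x, r', rfl⟩ := List.exists_cons_of_ne_nil this
    refine ⟨S.color x, Finset.mem_union_right _ (h2.colors_subset ?_)⟩
    simp

/-- Orientations survive when all strands are given one color, and then every sign vanishes. A
non-empty word with no strands at its top has at least one strand below its first slice, so the
color does occur. -/
theorem Labelled.recolor_closed (c : Bool) {w : Word Bool} {z : ℤ}
    {U : Finset Bool} (h : oriented.Labelled w [] [] z U) (hw : w ≠ []) :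
    oriented.Labelled w [] [] 0 {c} := by
  have := h.recolor c
  rwa [Finset.image_const (h.nonempty hw)] at this

/-- The part inside the circle gets the color `true` and the part outside gets `false`. No crossing
involves both parts, so all signs are zero. The given labelling only supplies the orientations. -/
theorem labelled_of_isSplit {D : LinkDiagram} (hD : D.IsSplit) {z : ℤ} {U : Finset Bool}
    (h : oriented.Labelled D.word [] [] z U) :
    oriented.Labelled D.word [] [] 0 Finset.univ := by
  obtain ⟨E, O, A, B, k, hE, hO, hAB, hw⟩ := hD
  rw [hw] at h ⊢
  obtain ⟨r, z₁, z₂, V, W, h1, h2, rfl, rfl⟩ := labelled_append.1 h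
  obtain ⟨s, z₃, z₄, V', W', h3, h4, rfl, rfl⟩ := labelled_append.1 h1
  have hk := (Word.run_of_shift hE h4.run).1
  obtain ⟨s₁, s₂, rfl, rfl⟩ : ∃ s₁ s₂, s = s₁ ++ s₂ ∧ s₁.length = k :=
    ⟨s.take k, s.drop k, by simp, by simpa using hk⟩
  obtain ⟨t', V, rfl, h5, rfl⟩ := labelled_shift.1 h4
  obtain ⟨t'', V'', rfl, h6, rfl⟩ := (labelled_add (s := []) E.closed).1 h5
  -- The inner diagram ends with no strands, so it can be removed and the labels around it fit
  -- together to a labelling of the outer diagram.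
  have h7 : t'' = [] := by
    have := h6.run
    rw [List.length_nil, E.closed] at this
    exact List.eq_nil_of_length_eq_zero (Option.some.inj this).symm
  subst h7
  have hO' : oriented.Labelled (A ++ B) [] [] (z₃ + z₂) (V' ∪ W) :=
    labelled_append.2 ⟨_, _, _, _, _, h3, h2, rfl, rfl⟩
  have h8 := hO'.recolor_closed false (hAB ▸ hO)
  obtain ⟨r, y₁, y₂, X₁, X₂, h9, h10, h11, h12⟩ := labelled_append.1 h8
  have h13 := h6.recolor_closed true hE
  have hlen : r.length = (s₁ ++ s₂).length := by
    have := h9.run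
    rw [h3.run] at this
    exact (Option.some.inj this).symm
  obtain ⟨r₁, r₂, rfl, hr⟩ : ∃ r₁ r₂, r = r₁ ++ r₂ ∧ r₁.length = s₁.length :=
    ⟨r.take s₁.length, r.drop s₁.length, by simp, by simp [hlen]⟩
  rw [← hr]
  refine labelled_append.2 ⟨_, _, _, _, _, labelled_append.2 ⟨_, _, _, _, _, h9,
    labelled_shift.2 ⟨_, _, rfl, (labelled_add (s := []) E.closed).2 ⟨[], _, rfl, h13, rfl⟩, rfl⟩,
    rfl, rfl⟩, h10, by simpa using h11, ?_⟩
  have h14 : X₁ ∪ X₂ = {false} := h12.symm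
  ext c
  have h15 : c ∈ X₁ ∪ X₂ ↔ c = false := by rw [h14]; simp
  simp only [Finset.mem_union] at h15
  cases c <;> simp at h15 ⊢
  tauto

/-- If every labelling with two colors has non-zero linking number, then the diagram does not
split. -/
theorem not_splittable {D : LinkDiagram} {z : ℤ} {U : Finset Bool}
    (h : oriented.Labelled D.word [] [] z U) (h0 : ¬ oriented.Labelled D.word [] [] 0 Finset.univ) :
    ¬ D.Splittable := by
  rintro ⟨D', he, hs⟩
  exact h0 (he.labelled_iff.2 (labelled_of_isSplit hs (he.labelled_iff.1 h)))

/-! ### Tangles with two arcs and the effect of a twist -/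

/-- How the endpoints of a tangle are connected by its two arcs. -/
inductive _root_.LinkGame.ArcPattern : Type
  | vertical | crossed | horizontal

variable (S : LabelSystem)

def top : ArcPattern → S.Label → S.Label → List S.Label
  | .vertical, x, y => [x, y]
  | .crossed, x, y => [x, y]
  | .horizontal, x, _ => [x, S.bar x]

def bottom : ArcPattern → S.Label → S.Label → List S.Label
  | .vertical, x, y => [x, y]
  | .crossed, x, y => [y, x]
  | .horizontal, _, y => [y, S.bar y]

/-- The labellings of the tangle are those of two arcs with the given connections that cross each
other, with signs that add up to `k` for suitable orientations. -/
structure IsTangle (T : Word Bool) (a : ArcPattern) (k : ℤ) : Prop where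
  run : T.run 2 = some 2
  eq : ∀ {x y t z U}, S.Labelled T [x, y] t z U → ∃ p q, [x, y] = S.top a p q ∧
    t = S.bottom a p q ∧ z = k * S.sign true p q ∧ U ⊆ {S.color p, S.color q}
  exists_labelled : ∀ p q, ∃ z U, S.Labelled T (S.top a p q) (S.bottom a p q) z U

def _root_.LinkGame.unit (b : Bool) : ℤ := if b then 1 else -1

theorem sign_eq {S : LabelSystem} (b : Bool) (x y : S.Label) :
    S.sign b x y = unit b * S.sign true x y := by
  cases b
  · have := S.sign_not true x y
    simpa [unit] using this
  · simp [unit]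

variable {S} {T : Word Bool} {k : ℤ}

theorem isTangle_nil : S.IsTangle [] .vertical 0 where
  run := rfl
  eq := by
    rintro x y t z U ⟨rfl, rfl, rfl⟩
    exact ⟨x, y, rfl, rfl, by simp, by simp⟩
  exists_labelled p q := ⟨_, _, rfl, rfl, rfl⟩

theorem run_bottomTwist (b : Bool) (h : T.run 2 = some 2) : (bottomTwist b T).run 2 = some 2 :=
  run_twists true b 1 T h

theorem run_rightTwist (b : Bool) (h : T.run 2 = some 2) : (rightTwist b T).run 2 = some 2 :=
  run_twists false b 1 T h

theorem Labelled.colors_bottom_subset {w : Word Bool} {s t : List S.Label} {z : ℤ}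
    {U : Finset Bool} (h : S.Labelled w s t z U) : S.colors t ⊆ U := by
  induction w generalizing s z U with
  | nil => obtain ⟨rfl, -, rfl⟩ := h; rfl
  | cons c w ih =>
    obtain ⟨r, z₁, z₂, V, -, h, -, rfl⟩ := h
    exact (ih h).trans Finset.subset_union_right

theorem labelled_bottomTwist {b : Bool} {x y : S.Label} {t : List S.Label} {z : ℤ} {U : Finset Bool}
    (hT : T.run 2 = some 2) :
    S.Labelled (bottomTwist b T) [x, y] t z U ↔
      ∃ p q z₁ V, S.Labelled T [x, y] [p, q] z₁ V ∧ t = [q, p] ∧ z = z₁ + S.sign b p q ∧ U = V := by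
  rw [bottomTwist, labelled_append]
  constructor
  · rintro ⟨r, z₁, z₂, V, W, h1, h2, rfl, rfl⟩
    have h3 := h1.colors_bottom_subset
    simp at h2
    obtain ⟨p, q, r, rfl, rfl, rfl, rfl⟩ := h2
    have h4 := h1.run
    rw [List.length_cons, List.length_singleton, hT] at h4
    simp at h4
    subst h4
    refine ⟨p, q, z₁, V, h1, rfl, rfl, ?_⟩
    refine Finset.union_eq_left.2 (Finset.Subset.trans ?_ h3)
    intro c; simp
  · rintro ⟨p, q, z₁, V, h1, rfl, rfl, rfl⟩
    refine ⟨_, z₁, _, U, S.colors [p, q], h1, ?_, rfl, ?_⟩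
    · simp
      exact Finset.pair_comm _ _
    · exact (Finset.union_eq_left.2 h1.colors_bottom_subset).symm

/-- Here `a` labels the left leg of the new maximum, so its right leg, labelled `S.bar a`, runs down
beside the tangle, crosses the incoming strand `y` and becomes the new right endpoint. The minimum
joins `y` to the old one, which forces the label `S.bar y` there. -/
theorem labelled_rightTwist {b : Bool} {x y : S.Label} {t : List S.Label} {z : ℤ} {U : Finset Bool}
    (hT : T.run 2 = some 2) :
    S.Labelled (rightTwist b T) [x, y] t z U ↔
      ∃ a p z₁ V, S.Labelled T [x, a] [p, S.bar y] z₁ V ∧ t = [p, S.bar a] ∧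
        z = z₁ + S.sign b (S.bar a) y ∧ U = insert (S.color y) V := by
  have hcons : rightTwist b T = ⟨1, .cap⟩ :: (T ++ [⟨2, .cross b⟩, ⟨1, .cup⟩]) := by
    simp [rightTwist]
  rw [hcons, labelled_cons]
  constructor
  · rintro ⟨r, z₁, z₂, V, h1, h2, rfl, rfl⟩
    simp at h1
    obtain ⟨⟨a, rfl⟩, rfl⟩ := h1
    obtain ⟨r, z₁, z₃, V, W, h3, h4, rfl, rfl⟩ := labelled_append.1 h2
    obtain ⟨v, V', rfl, h5, rfl⟩ :=
      (labelled_add (s := [x, a]) (r := [S.bar a, y]) hT).1 h3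
    have h6 := h5.run
    rw [List.length_cons, List.length_singleton, hT] at h6
    obtain ⟨p, q, rfl⟩ := List.length_eq_two.1 (Option.some.inj h6).symm
    have h7 := h5.colors_bottom_subset
    have h8 := h5.colors_subset
    simp at h4
    obtain ⟨⟨rfl, rfl⟩, rfl, rfl⟩ := h4
    refine ⟨a, p, z₁, V', by simpa using h5, rfl, by rw [sign_bar_left]; ring, ?_⟩
    simp [Finset.insert_subset_iff] at h7 h8
    ext c
    have h9 : c = S.color x → c ∈ V' := by rintro rfl; exact h8.1
    have h10 : c = S.color a → c ∈ V' := by rintro rfl; exact h8.2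
    have h11 : c = S.color p → c ∈ V' := by rintro rfl; exact h7.1
    simp
    tauto
  · rintro ⟨a, p, z₁, V, h1, rfl, rfl, rfl⟩
    have h7 := h1.colors_bottom_subset
    have h8 := h1.colors_subset
    refine ⟨[x, a, S.bar a, y], 0, _, _, by simp, labelled_append.2 ⟨_, z₁, _, _, _,
      (labelled_add (s := [x, a]) (r := [S.bar a, y]) hT).2 ⟨_, _, rfl, h1, rfl⟩,
      by simp; exact ⟨rfl, rfl⟩, rfl, rfl⟩, by simp, ?_⟩
    simp [Finset.insert_subset_iff] at h7 h8
    ext c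
    have h9 : c = S.color x → c ∈ V := by rintro rfl; exact h8.1
    have h10 : c = S.color a → c ∈ V := by rintro rfl; exact h8.2
    have h11 : c = S.color p → c ∈ V := by rintro rfl; exact h7.1
    simp
    tauto

theorem IsTangle.bottom_vertical (h : S.IsTangle T .vertical k) (b : Bool) :
    S.IsTangle (bottomTwist b T) .crossed (k + unit b) where
  run := run_bottomTwist b h.run
  eq := by
    intro x y t z U h'
    obtain ⟨p, q, z₁, V, h1, rfl, rfl, rfl⟩ := (labelled_bottomTwist h.run).1 h'
    obtain ⟨p', q', h2, h3, rfl, h4⟩ := h.eq h1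
    simp only [top, bottom, List.cons.injEq, and_true] at h2 h3
    obtain ⟨rfl, rfl⟩ := h2
    obtain ⟨rfl, rfl⟩ := h3
    exact ⟨p, q, rfl, rfl, by rw [sign_eq b]; ring, h4⟩
  exists_labelled p q := by
    obtain ⟨z, U, h1⟩ := h.exists_labelled p q
    exact ⟨_, _, (labelled_bottomTwist h.run).2 ⟨_, _, _, _, h1, rfl, rfl, rfl⟩⟩

theorem IsTangle.bottom_crossed (h : S.IsTangle T .crossed k) (b : Bool) :
    S.IsTangle (bottomTwist b T) .vertical (k + unit b) where
  run := run_bottomTwist b h.run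
  eq := by
    intro x y t z U h'
    obtain ⟨p, q, z₁, V, h1, rfl, rfl, rfl⟩ := (labelled_bottomTwist h.run).1 h'
    obtain ⟨p', q', h2, h3, rfl, h4⟩ := h.eq h1
    simp only [top, bottom, List.cons.injEq, and_true] at h2 h3
    obtain ⟨rfl, rfl⟩ := h2
    obtain ⟨rfl, rfl⟩ := h3
    exact ⟨q, p, rfl, rfl, by rw [sign_eq b, S.sign_comm true p q]; ring, h4⟩
  exists_labelled p q := by
    obtain ⟨z, U, h1⟩ := h.exists_labelled p q
    exact ⟨_, _, (labelled_bottomTwist h.run).2 ⟨_, _, _, _, h1, rfl, rfl, rfl⟩⟩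

/-- Both arcs traverse the new crossing against the direction of their labels `p` and `q`. The two
reversals cancel, so that its slope is added to `k` with the same sign as for a bottom twist. -/
theorem IsTangle.right_crossed (h : S.IsTangle T .crossed k) (b : Bool) :
    S.IsTangle (rightTwist b T) .horizontal (k + unit b) where
  run := run_rightTwist b h.run
  eq := by
    intro x y t z U h'
    obtain ⟨a, p, z₁, V, h1, rfl, rfl, rfl⟩ := (labelled_rightTwist h.run).1 h'
    obtain ⟨p', q', h2, h3, rfl, h4⟩ := h.eq h1
    simp only [top, bottom, List.cons.injEq, and_true] at h2 h3
    obtain ⟨rfl, rfl⟩ := h2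
    obtain ⟨rfl, h5⟩ := h3
    obtain rfl : y = S.bar x := by rw [← h5, S.bar_bar]
    refine ⟨x, p, rfl, rfl, ?_, ?_⟩
    · rw [sign_bar, sign_bar_left, sign_eq b, S.sign_comm true p x]; ring
    · rw [S.color_bar]
      exact Finset.insert_subset (by simp) h4
  exists_labelled p q := by
    obtain ⟨z, U, h1⟩ := h.exists_labelled p q
    exact ⟨_, _, (labelled_rightTwist h.run).2 ⟨q, q, _, _,
      by simpa [top, bottom] using h1, rfl, rfl, rfl⟩⟩

theorem IsTangle.right_horizontal (h : S.IsTangle T .horizontal k) (b : Bool) :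
    S.IsTangle (rightTwist b T) .crossed (k + unit b) where
  run := run_rightTwist b h.run
  eq := by
    intro x y t z U h'
    obtain ⟨a, p, z₁, V, h1, rfl, rfl, rfl⟩ := (labelled_rightTwist h.run).1 h'
    obtain ⟨p', q', h2, h3, rfl, h4⟩ := h.eq h1
    simp only [top, bottom, List.cons.injEq, and_true] at h2 h3
    obtain ⟨rfl, rfl⟩ := h2
    obtain ⟨rfl, h5⟩ := h3
    obtain rfl : y = p := by rw [← S.bar_bar y, h5, S.bar_bar]
    refine ⟨x, y, rfl, by simp [bottom], ?_, ?_⟩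
    · rw [S.bar_bar, sign_eq b]; ring
    · exact Finset.insert_subset (by simp) h4
  exists_labelled p q := by
    obtain ⟨z, U, h1⟩ := h.exists_labelled p q
    exact ⟨_, _, (labelled_rightTwist h.run).2 ⟨S.bar p, q, _, _,
      by simpa [top, bottom] using h1, by simp [bottom], rfl, rfl⟩⟩

/-! ### Labellings of the two closures -/

theorem labelled_numeratorWord {z : ℤ} {U : Finset Bool} :
    S.Labelled (numeratorWord T) [] [] z U ↔
      ∃ x y, S.Labelled T [x, S.bar x] [y, S.bar y] z U := by
  have hcons : numeratorWord T = ⟨0, .cap⟩ :: (T ++ [⟨0, .cup⟩]) := by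
    simp [numeratorWord]
  rw [hcons, labelled_cons]
  constructor
  · rintro ⟨r, z₁, z₂, V, h1, h2, rfl, rfl⟩
    simp at h1
    obtain ⟨rfl, x, rfl⟩ := h1
    obtain ⟨r, z₁, z₃, V, W, h3, h4, rfl, rfl⟩ := labelled_append.1 h2
    simp at h4
    obtain ⟨⟨y, rfl⟩, rfl, rfl⟩ := h4
    refine ⟨x, y, ?_⟩
    have h7 := h3.colors_bottom_subset
    rw [colors_nil, Finset.empty_union, zero_add, add_zero, Finset.union_eq_left.2 h7]
    exact h3
  · rintro ⟨x, y, h⟩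
    refine ⟨[x, S.bar x], 0, z, U, by simp, labelled_append.2 ⟨_, z, 0, U, _, h,
      by simp; rfl, by simp, ?_⟩, by simp, by simp⟩
    have h7 := h.colors_bottom_subset
    simp at h7 ⊢
    exact (Finset.insert_eq_of_mem h7).symm

theorem labelled_denominatorWord {z : ℤ} {U : Finset Bool} (hT : T.run 2 = some 2) :
    S.Labelled (denominatorWord T) [] [] z U ↔
      ∃ x y V, S.Labelled T [x, y] [x, y] z V ∧ U = insert (S.color x) (insert (S.color y) V) := by
  have hcons : denominatorWord T = ⟨0, .cap⟩ :: ⟨2, .cap⟩ :: (T.shift 1 ++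
      [⟨0, .cup⟩, ⟨0, .cup⟩]) := by
    simp [denominatorWord]
  rw [hcons]
  constructor
  · rintro ⟨r, z₁, z₂, V, h1, ⟨r', z₃, z₄, V', h2, h3, rfl, rfl⟩, rfl, rfl⟩
    simp at h1
    obtain ⟨rfl, x, rfl⟩ := h1
    simp at h2
    obtain ⟨⟨y, rfl⟩, rfl⟩ := h2
    obtain ⟨r, z₁, z₃, V, W, h5, h4, rfl, rfl⟩ := labelled_append.1 h3
    obtain ⟨t', V, rfl, h7, rfl⟩ := labelled_shift_one.1 h5
    obtain ⟨v, V', rfl, h6, rfl⟩ :=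
      (labelled_add (s := [S.bar x, y]) (r := [S.bar y]) hT).1 h7
    have h7 := h6.run
    rw [List.length_cons, List.length_singleton, hT] at h7
    obtain ⟨p, q, rfl⟩ := List.length_eq_two.1 (Option.some.inj h7).symm
    simp at h4
    obtain ⟨rfl, h8, rfl, rfl⟩ := h4
    obtain rfl : y = q := by rw [← S.bar_bar y, h8, S.bar_bar]
    refine ⟨_, _, V', by simpa using h6, ?_⟩
    ext c; simp; tauto
  · rintro ⟨x, y, V, h, rfl⟩
    refine ⟨[S.bar x, x], 0, z, _, by simp, ⟨[S.bar x, x, y, S.bar y], 0, z, _, by simp,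
      labelled_append.2 ⟨_, z, 0, _, _,
      labelled_shift_one.2 ⟨_, _, rfl, (labelled_add (s := [x, y]) (r := [S.bar y]) hT).2
        ⟨_, _, rfl, h, rfl⟩, rfl⟩, by simp; rfl, by simp, rfl⟩, by simp, rfl⟩, by simp, ?_⟩
    ext c; simp; tauto

theorem labelled_numerator_horizontal (h : S.IsTangle T .horizontal k) {z : ℤ} {U : Finset Bool}
    (hU : S.Labelled (numeratorWord T) [] [] z U) :
    ∃ p q, z = k * S.sign true p q ∧ U ⊆ {S.color p, S.color q} := by
  obtain ⟨x, y, h1⟩ := labelled_numeratorWord.1 hU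
  obtain ⟨p, q, -, -, h2⟩ := h.eq h1
  exact ⟨p, q, h2⟩

theorem labelled_denominator_vertical (h : S.IsTangle T .vertical k) {z : ℤ} {U : Finset Bool}
    (hU : S.Labelled (denominatorWord T) [] [] z U) :
    ∃ p q, z = k * S.sign true p q ∧ U ⊆ {S.color p, S.color q} := by
  obtain ⟨x, y, V, h1, rfl⟩ := (labelled_denominatorWord h.run).1 hU
  obtain ⟨p, q, h2, -, h3, h4⟩ := h.eq h1
  simp only [top, List.cons.injEq, and_true] at h2
  obtain ⟨rfl, rfl⟩ := h2
  refine ⟨x, y, h3, ?_⟩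
  exact Finset.insert_subset (by simp) (Finset.insert_subset (by simp) h4)

/-- The maximum of the closure joins the top ends of the two vertical arcs, so they lie on one
component and share a color. -/
theorem labelled_numerator_vertical (h : S.IsTangle T .vertical k) {z : ℤ} {U : Finset Bool}
    (hU : S.Labelled (numeratorWord T) [] [] z U) : ∃ c, U ⊆ {c} := by
  obtain ⟨x, y, h1⟩ := labelled_numeratorWord.1 hU
  obtain ⟨p, q, h2, -, -, h3⟩ := h.eq h1
  simp only [top, List.cons.injEq, and_true] at h2
  obtain ⟨rfl, rfl⟩ := h2
  exact ⟨S.color x, by simpa using h3⟩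

theorem labelled_denominator_horizontal (h : S.IsTangle T .horizontal k) {z : ℤ} {U : Finset Bool}
    (hU : S.Labelled (denominatorWord T) [] [] z U) : ∃ c, U ⊆ {c} := by
  obtain ⟨x, y, V, h1, rfl⟩ := (labelled_denominatorWord h.run).1 hU
  obtain ⟨p, q, h2, h3, -, h4⟩ := h.eq h1
  simp only [top, bottom, List.cons.injEq, and_true] at h2 h3
  obtain ⟨rfl, rfl⟩ := h2
  obtain ⟨rfl, -⟩ := h3
  exact ⟨S.color x, by simpa only [Finset.insert_subset_iff, color_bar, Finset.mem_singleton,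
    true_and, Finset.pair_eq_singleton] using h4⟩

theorem exists_labelled_numerator (h : S.IsTangle T .horizontal k) (p : S.Label) :
    ∃ z U, S.Labelled (numeratorWord T) [] [] z U := by
  obtain ⟨z, U, h1⟩ := h.exists_labelled p p
  exact ⟨z, U, labelled_numeratorWord.2 ⟨_, _, h1⟩⟩

theorem exists_labelled_denominator (h : S.IsTangle T .vertical k) (p : S.Label) :
    ∃ z U, S.Labelled (denominatorWord T) [] [] z U := by
  obtain ⟨z, U, h1⟩ := h.exists_labelled p p
  exact ⟨z, _, (labelled_denominatorWord h.run).2 ⟨_, _, _, h1, rfl⟩⟩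

theorem oriented_sign_ne_zero {p q : oriented.Label}
    (h : Finset.univ ⊆ ({oriented.color p, oriented.color q} : Finset Bool)) :
    oriented.sign true p q ≠ 0 := by
  have key : ∀ p q : Bool × Bool, Finset.univ ⊆ ({p.1, q.1} : Finset Bool) →
      (if p.1 = q.1 then (0 : ℤ) else if true = (p.2 == q.2) then 1 else -1) ≠ 0 := by decide
  exact key p q h

end LabelSystem
end LinkGame

/-! ### Rational tangles as sequences of twists, and the linking number of their closures -/

namespace LinkGame

/-- Perform one twist for each entry; the first component of an entry tells whether the bottom or
the right endpoints are twisted. -/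
def twistAlong {κ : Type} : List (Bool × κ) → Word κ → Word κ
  | [], T => T
  | (f, c) :: l, T => twistAlong l ((if f then bottomTwist c else rightTwist c) T)

/-- The sequence of twists in the syllables of a rational tangle. -/
def syllableTwists : Bool → List ℤ → List (Bool × Bool)
  | _, [] => []
  | f, a :: as => List.replicate a.natAbs (f, decide (0 < a)) ++ syllableTwists (!f) as

/-- Close a tangle. -/
def Closure.word {κ : Type} : Closure → Word κ → Word κ
  | .numerator, T => numeratorWord T
  | .denominator, T => denominatorWord T

theorem twistAlong_append {κ : Type} (l l' : List (Bool × κ)) (T : Word κ) :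
    twistAlong (l ++ l') T = twistAlong l' (twistAlong l T) := by
  induction l generalizing T with
  | nil => rfl
  | cons x l ih => exact ih _

theorem twists_succ_left {κ : Type} (f : Bool) (c : κ) (k : ℕ) (T : Word κ) :
    twists f c (k + 1) T = twists f c k ((if f then bottomTwist c else rightTwist c) T) := by
  induction k with
  | zero => rfl
  | succ k ih => rw [twists, ih]; rfl

theorem twistAlong_replicate {κ : Type} (f : Bool) (c : κ) (k : ℕ) (T : Word κ) :
    twistAlong (List.replicate k (f, c)) T = twists f c k T := by
  induction k generalizing T with
  | zero => rfl
  | succ k ih => rw [twists_succ_left, ← ih]; rfl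

theorem addSyllables_eq (f : Bool) (a : List ℤ) (T : Word Bool) :
    addSyllables f a T = twistAlong (syllableTwists f a) T := by
  induction a generalizing f T with
  | nil => rfl
  | cons a as ih => rw [addSyllables, ih, syllableTwists, twistAlong_append, twistAlong_replicate]

theorem rationalLink_word (c : Closure) (a : List ℤ) :
    (rationalLink c a).word = c.word (twistAlong (syllableTwists true a) []) := by
  rw [← addSyllables_eq]
  cases c <;> rfl

/-- A list made of consecutive pairs of entries that are related by `R`. -/
inductive Paired {α : Type} (R : α → α → Prop) : List α → Prop
  | nil : Paired R []
  | cons {x y : α} {l : List α} : R x y → Paired R l → Paired R (x :: y :: l)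

theorem Paired.append {α : Type} {R : α → α → Prop} {l l' : List α} (h : Paired R l)
    (h' : Paired R l') : Paired R (l ++ l') := by
  induction h with
  | nil => exact h'
  | cons hxy _ ih => exact .cons hxy ih

theorem paired_replicate {α : Type} {R : α → α → Prop} {x : α} (hx : R x x) {k : ℕ}
    (hk : Even k) : Paired R (List.replicate k x) := by
  obtain ⟨m, rfl⟩ := hk
  induction m with
  | zero => exact .nil
  | succ m ih =>
    rw [show m + 1 + (m + 1) = m + m + 1 + 1 by omega]
    exact .cons hx ih

theorem Paired.length_even {α : Type} {R : α → α → Prop} {l : List α} (h : Paired R l) :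
    Even l.length := by
  induction h with
  | nil => exact ⟨0, rfl⟩
  | cons _ _ ih =>
    obtain ⟨m, hm⟩ := ih
    exact ⟨m + 1, by simp only [List.length_cons]; omega⟩

theorem map_fst_syllableTwists_even (f : Bool) (as : List ℤ) (b : ℤ) (has : ∀ a ∈ as, Even a)
    (hb : Odd b) : ∃ m f', Paired (· = ·) m ∧
      (syllableTwists f (as ++ [b])).map Prod.fst = m ++ [f'] := by
  induction as generalizing f with
  | nil =>
    obtain ⟨k, hk⟩ := Int.natAbs_odd.2 hb
    refine ⟨List.replicate (2 * k) f, f, paired_replicate rfl (even_two_mul k), ?_⟩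
    simp [syllableTwists, hk, List.replicate_succ']
  | cons a as ih =>
    obtain ⟨m, f', h1, h2⟩ := ih (!f) fun x hx => has x (List.mem_cons_of_mem _ hx)
    refine ⟨List.replicate a.natAbs f ++ m, f', ?_, ?_⟩
    · exact (paired_replicate rfl (Int.natAbs_even.2 (has a List.mem_cons_self))).append h1
    · simp [syllableTwists, h2]

/-- One twist is split off from the first syllable and one from the last syllable. What remains of
every syllable has even length, hence falls into pairs of twists of the same kind. -/
theorem map_fst_syllableTwists (a b : ℤ) (as : List ℤ) (ha : Odd a) (has : ∀ x ∈ as, Even x)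
    (hb : Odd b) : ∃ m f, Paired (· = ·) m ∧
      (syllableTwists true (a :: (as ++ [b]))).map Prod.fst = true :: (m ++ [f]) := by
  obtain ⟨m, f, h1, h2⟩ := map_fst_syllableTwists_even false as b has hb
  obtain ⟨k, hk⟩ := Int.natAbs_odd.2 ha
  refine ⟨List.replicate (2 * k) true ++ m, f,
    (paired_replicate rfl (even_two_mul k)).append h1, ?_⟩
  simp [syllableTwists, hk, h2, List.replicate_succ]

/-- The sum of the signs of the crossings. -/
def total (d : List Bool) : ℤ := (d.map unit).sum

namespace LabelSystem

variable {S : LabelSystem}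

/-- Two bottom twists lead from crossed arcs to vertical arcs and back, two right twists to
horizontal arcs and back. -/
theorem IsTangle.twistAlong_paired {l : List (Bool × Bool)} (hl : Paired (· = ·) (l.map Prod.fst))
    {T : Word Bool} {k : ℤ} (h : S.IsTangle T .crossed k) :
    S.IsTangle (twistAlong l T) .crossed (k + total (l.map Prod.snd)) := by
  generalize hm : l.map Prod.fst = m at hl
  induction hl generalizing l T k with
  | nil =>
    obtain rfl := List.map_eq_nil_iff.1 hm
    simpa [twistAlong, total] using h
  | @cons f g m hfg _ ih =>
    subst hfg
    match l with
    | [] | [_] => simp at hm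
    | (f₁, b₁) :: (f₂, b₂) :: l =>
      simp only [List.map_cons, List.cons.injEq] at hm
      obtain ⟨rfl, rfl, hm⟩ := hm
      have key : S.IsTangle (twistAlong [(f₂, b₁), (f₂, b₂)] T) .crossed
          (k + unit b₁ + unit b₂) := by
        cases f₂
        · exact (h.right_crossed b₁).right_horizontal b₂
        · exact (h.bottom_crossed b₁).bottom_vertical b₂
      have := ih key hm
      have heq : k + total (((f₂, b₁) :: (f₂, b₂) :: l).map Prod.snd) =
          k + unit b₁ + unit b₂ + total (l.map Prod.snd) := by simp [total]; ring
      rw [heq]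
      exact this

theorem isTangle_twistAlong {l : List (Bool × Bool)} {m : List Bool} {f : Bool}
    (hm : Paired (· = ·) m) (hl : l.map Prod.fst = true :: (m ++ [f])) :
    S.IsTangle (twistAlong l []) (if f then .vertical else .horizontal)
      (total (l.map Prod.snd)) := by
  match l with
  | [] => simp at hl
  | (f₁, b₁) :: l =>
    simp only [List.map_cons, List.cons.injEq] at hl
    obtain ⟨rfl, hl⟩ := hl
    obtain ⟨l₁, l₂, rfl, h1, h2⟩ := List.map_eq_append_iff.1 hl
    obtain ⟨⟨f₂, b₂⟩, rfl, rfl⟩ := List.map_eq_singleton_iff.1 h2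
    have h3 := (isTangle_nil (S := S)).bottom_vertical b₁
    have h4 := h3.twistAlong_paired (l := l₁) (by rw [h1]; exact hm)
    have heq : total (((true, b₁) :: (l₁ ++ [(f₂, b₂)])).map Prod.snd) =
        0 + unit b₁ + total (l₁.map Prod.snd) + unit b₂ := by simp [total]; ring
    rw [heq, twistAlong, twistAlong_append]
    cases f₂
    · exact h4.right_crossed b₂
    · exact h4.bottom_crossed b₂

end LabelSystem

/-- The closure for which the two arcs of the tangle lie on different components, when the last
twist is a bottom twist or a right twist. -/
def goodClosure (f : Bool) : Closure := if f then .denominator else .numerator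

theorem not_splittable_of_total_ne_zero {l : List (Bool × Bool)} {m : List Bool} {f : Bool}
    (hm : Paired (· = ·) m) (hl : l.map Prod.fst = true :: (m ++ [f]))
    (h0 : total (l.map Prod.snd) ≠ 0) {D : LinkDiagram}
    (hD : D.word = (goodClosure f).word (twistAlong l [])) : ¬ D.Splittable := by
  have h := LabelSystem.isTangle_twistAlong (S := .oriented) hm hl
  have key : (∃ z U, LabelSystem.oriented.Labelled D.word [] [] z U) ∧
      ∀ {z U}, LabelSystem.oriented.Labelled D.word [] [] z U → ∃ p q : LabelSystem.oriented.Label,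
        z = total (l.map Prod.snd) * LabelSystem.oriented.sign true p q ∧
        U ⊆ {LabelSystem.oriented.color p, LabelSystem.oriented.color q} := by
    rw [hD]
    cases f
    · exact ⟨LabelSystem.exists_labelled_numerator h (true, true),
        LabelSystem.labelled_numerator_horizontal h⟩
    · exact ⟨LabelSystem.exists_labelled_denominator h (true, true),
        LabelSystem.labelled_denominator_vertical h⟩
  obtain ⟨⟨z, U, h1⟩, h2⟩ := key
  refine LabelSystem.not_splittable h1 fun h3 => ?_
  obtain ⟨p, q, h4, h5⟩ := h2 h3
  rcases mul_eq_zero.1 h4.symm with h6 | h6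
  · exact h0 h6
  · exact LabelSystem.oriented_sign_ne_zero h5 h6

/-- The other closure joins both arcs to a single component, so its labellings have only one color.
-/
theorem eq_goodClosure {l : List (Bool × Bool)} {m : List Bool} {f : Bool}
    (hm : Paired (· = ·) m) (hl : l.map Prod.fst = true :: (m ++ [f])) {c : Closure} {z : ℤ}
    (h : LabelSystem.plain.Labelled (c.word (twistAlong l [])) [] [] z Finset.univ) :
    c = goodClosure f := by
  have ht := LabelSystem.isTangle_twistAlong (S := .plain) hm hl
  have key : ∀ b : Bool, ¬ (Finset.univ : Finset Bool) ⊆ {b} := by decide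
  cases c <;> cases f
  · rfl
  · obtain ⟨b, hb⟩ := LabelSystem.labelled_numerator_vertical ht h
    exact absurd hb (key b)
  · obtain ⟨b, hb⟩ := LabelSystem.labelled_denominator_horizontal ht h
    exact absurd hb (key b)
  · rfl

/-! ### From two components to a coloring with two colors -/

namespace LabelSystem

theorem map_range_succ {α : Type} (h : ℕ → α) (m : ℕ) :
    (List.range (m + 1)).map h = h 0 :: (List.range m).map (fun p => h (p + 1)) := by
  rw [List.range_succ_eq_map, List.map_cons, List.map_map]; rfl

/-- The hypotheses are the clauses of `Word.Joined` for a single slice, with `h₀` and `h₁` coloring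
the levels above and below it. The induction removes the strands on the left one at a time. -/
theorem plain_pass {i m : ℕ} {g : Piece Bool} {h₀ h₁ : ℕ → plain.Label} (hi : i + g.inn ≤ m)
    (left : ∀ p < i, h₀ p = h₁ p)
    (right : ∀ k, i + g.inn + k < m → h₀ (i + g.inn + k) = h₁ (i + g.out + k))
    (cap : g = .cap → h₁ i = h₁ (i + 1)) (cup : g = .cup → h₀ i = h₀ (i + 1))
    (cross : ∀ b, g = .cross b → h₀ i = h₁ (i + 1) ∧ h₀ (i + 1) = h₁ i) :
    plain.Pass i g ((List.range m).map h₀) ((List.range (m - g.inn + g.out)).map h₁) 0 := by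
  induction i generalizing m h₀ h₁ with
  | zero =>
    cases g with
    | cap =>
      refine ⟨rfl, h₁ 0, ?_⟩
      simp only [Piece.inn, Piece.out, Nat.sub_zero, Nat.zero_add, Nat.add_zero] at right hi ⊢
      rw [map_range_succ, map_range_succ, ← cap rfl]
      refine congrArg _ (congrArg _ (List.map_congr_left fun p hp => ?_))
      rw [right p (List.mem_range.1 hp), Nat.add_comm 2 p]
    | cup =>
      refine ⟨rfl, h₀ 0, ?_⟩
      obtain ⟨m, rfl⟩ : ∃ m', m = m' + 2 := ⟨m - 2, by simp at hi; omega⟩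
      simp only [Piece.inn, Piece.out, Nat.zero_add, Nat.add_zero, Nat.add_sub_cancel] at right ⊢
      rw [map_range_succ, map_range_succ, ← cup rfl]
      refine congrArg _ (congrArg _ (List.map_congr_left fun p hp => ?_))
      rw [← right p (by have := List.mem_range.1 hp; omega), Nat.add_comm 2 p]
    | cross b =>
      obtain ⟨m, rfl⟩ : ∃ m', m = m' + 2 := ⟨m - 2, by simp at hi; omega⟩
      simp only [Piece.inn, Piece.out, Nat.zero_add, Nat.add_sub_cancel] at right ⊢
      refine ⟨h₀ 0, h₀ 1, (List.range m).map (fun p => h₀ (p + 1 + 1)), ?_, ?_, rfl⟩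
      · rw [map_range_succ, map_range_succ]
      · have h := cross b rfl
        simp only [Nat.zero_add] at h
        rw [map_range_succ, map_range_succ, h.1, h.2]
        refine congrArg _ (congrArg _ (List.map_congr_left fun p hp => ?_))
        have := right p (by have := List.mem_range.1 hp; omega)
        rw [Nat.add_comm 2 p] at this
        exact this.symm
  | succ i ih =>
    obtain ⟨m, rfl⟩ : ∃ m', m = m' + 1 := ⟨m - 1, by omega⟩
    refine ⟨h₀ 0, (List.range m).map (fun p => h₀ (p + 1)),
      (List.range (m - g.inn + g.out)).map (fun p => h₁ (p + 1)), map_range_succ _ _, ?_, ?_⟩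
    · rw [show m + 1 - g.inn + g.out = m - g.inn + g.out + 1 by omega, map_range_succ,
        left 0 (Nat.succ_pos i)]
    · refine ih (by omega) (fun p hp => left _ (by omega)) (fun k hk => ?_) cap cup cross
      have := right k (by omega)
      rw [show i + 1 + g.inn + k = i + g.inn + k + 1 by omega,
        show i + 1 + g.out + k = i + g.out + k + 1 by omega] at this
      exact this

theorem mem_colors_map (g : ℕ → ℕ → plain.Label) {m p : ℕ} (hp : p < m) :
    plain.color (g 0 p) ∈ plain.colors ((List.range m).map (g 0)) := by
  rw [colors, List.mem_toFinset]
  exact List.mem_map_of_mem (List.mem_map_of_mem (List.mem_range.2 hp))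

/-- `x` is a point of the word with `m` strands at its top. -/
def _root_.LinkGame.Word.IsPoint {κ : Type} (m : ℕ) (w : Word κ) (x : ℕ × ℕ) : Prop :=
  ∃ n, Word.run m (w.take x.1) = some n ∧ x.2 < n

theorem _root_.LinkGame.Word.Joined.cons {κ : Type} {w : Word κ} {x y : ℕ × ℕ} (c : Slice κ)
    (h : Word.Joined w x y) : Word.Joined (c :: w) (x.1 + 1, x.2) (y.1 + 1, y.2) := by
  cases h with
  | left h hp => exact .left h hp
  | right k h => exact .right k h
  | cap h => exact .cap h
  | cup h => exact .cup h
  | crossDown h => exact .crossDown h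
  | crossUp h => exact .crossUp h

/-- A coloring of the points that is constant along the arcs is a labelling. -/
theorem plain_labelled {w : Word Bool} {m n : ℕ} (hw : w.run m = some n)
    (g : ℕ → ℕ → plain.Label)
    (hg : ∀ x y, w.Joined x y → Word.IsPoint m w x → Word.IsPoint m w y → g x.1 x.2 = g y.1 y.2) :
    ∃ z U, plain.Labelled w ((List.range m).map (g 0)) ((List.range n).map (g w.length)) z U ∧
      ∀ l p, Word.IsPoint m w (l, p) → l ≤ w.length →
        plain.color (g l p) ∈ U := by
  induction w generalizing m g with
  | nil =>
    obtain rfl := Option.some.inj hw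
    refine ⟨0, _, ⟨rfl, rfl, rfl⟩, ?_⟩
    rintro l p ⟨n, h1, h2⟩ hl
    obtain rfl : l = 0 := by simpa using hl
    obtain rfl := Option.some.inj h1
    exact mem_colors_map g h2
  | cons c w ih =>
    obtain ⟨i, q⟩ := c
    rw [Word.run] at hw
    split at hw
    · rename_i hi
      dsimp only at hi hw
      have hpt : ∀ x : ℕ × ℕ, Word.IsPoint (m - q.inn + q.out) w x →
          Word.IsPoint m (⟨i, q⟩ :: w) (x.1 + 1, x.2) := by
        rintro ⟨l, p⟩ ⟨n, h1, h2⟩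
        refine ⟨n, ?_, h2⟩
        rw [List.take_succ_cons, Word.run, if_pos hi]
        exact h1
      have hpt0 : ∀ p < m, Word.IsPoint m (⟨i, q⟩ :: w) (0, p) := fun p hp => ⟨m, rfl, hp⟩
      have hpt1 : ∀ p < m - q.inn + q.out, Word.IsPoint m (⟨i, q⟩ :: w) (1, p) :=
        fun p hp => hpt (0, p) ⟨_, rfl, hp⟩
      obtain ⟨z, U, h1, h2⟩ := ih hw (fun l => g (l + 1)) fun x y h hx hy =>
        hg _ _ (h.cons _) (hpt _ hx) (hpt _ hy)
      have hpass : plain.Pass i q ((List.range m).map (g 0))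
          ((List.range (m - q.inn + q.out)).map (g 1)) 0 := by
        refine plain_pass hi (fun p hp => ?_) (fun k hk => ?_) ?_ ?_ ?_
        · exact hg (0, p) (1, p) (.left rfl hp) (hpt0 _ (by omega)) (hpt1 _ (by omega))
        · exact hg (0, _) (1, _) (.right k rfl) (hpt0 _ (by omega)) (hpt1 _ (by omega))
        · rintro rfl
          simp only [Piece.inn, Piece.out] at hi hpt1
          exact hg (1, _) (1, _) (.cap rfl) (hpt1 _ (by omega)) (hpt1 _ (by omega))
        · rintro rfl
          simp only [Piece.inn] at hi
          exact hg (0, _) (0, _) (.cup rfl) (hpt0 _ (by omega)) (hpt0 _ (by omega))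
        · rintro b rfl
          simp only [Piece.inn, Piece.out] at hi hpt1
          exact ⟨hg (0, _) (1, _) (.crossDown rfl) (hpt0 _ (by omega)) (hpt1 _ (by omega)),
            hg (0, _) (1, _) (.crossUp rfl) (hpt0 _ (by omega)) (hpt1 _ (by omega))⟩
      refine ⟨0 + z, _, ⟨_, 0, z, U, hpass, h1, rfl, rfl⟩, ?_⟩
      rintro l p ⟨n', h3, h4⟩ hl
      rw [Finset.mem_union]
      cases l with
      | zero =>
        left
        obtain rfl := Option.some.inj h3
        exact mem_colors_map g h4
      | succ l =>
        right
        rw [List.take_succ_cons, Word.run, if_pos hi] at h3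
        exact h2 l p ⟨n', h3, h4⟩ (by simpa using hl)
    · simp at hw

theorem _root_.LinkGame.LinkDiagram.exists_plain_labelled {D : LinkDiagram}
    (h : D.numComponents = 2) : ∃ z, plain.Labelled D.word [] [] z Finset.univ := by
  classical
  obtain ⟨a, b, hab, -⟩ := Nat.card_eq_two_iff.1 h
  -- The component `a` gets the color `true` and the other one `false`; the value off the diagram is
  -- never used.
  let g : ℕ → ℕ → plain.Label := fun l p =>
    if hx : Word.IsPoint 0 D.word (l, p) then decide (Quot.mk _ ⟨(l, p), hx⟩ = a) else false
  have hgpos : ∀ l p (hx : Word.IsPoint 0 D.word (l, p)),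
      g l p = decide ((Quot.mk _ ⟨(l, p), hx⟩ : D.Component) = a) := fun l p hx => dif_pos hx
  have hpoint : ∀ c : D.Component, ∃ l p, Word.IsPoint 0 D.word (l, p) ∧ l ≤ D.word.length ∧
      g l p = decide (c = a) := by
    intro c
    obtain ⟨⟨⟨l, p⟩, hx⟩, rfl⟩ := Quot.exists_rep c
    refine ⟨l, p, hx, ?_, hgpos l p hx⟩
    by_contra hl
    obtain ⟨n, h1, h2⟩ := hx
    -- Beyond the last slice the truncated word is the whole word, which ends with no strands, so
    -- there are no points.
    rw [List.take_of_length_le (by omega), D.closed] at h1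
    obtain rfl := Option.some.inj h1
    exact absurd h2 (Nat.not_lt_zero _)
  obtain ⟨z, U, h1, h2⟩ := plain_labelled D.closed g (by
    rintro ⟨l, p⟩ ⟨l', p'⟩ hxy hx hy
    have : (Quot.mk _ ⟨(l, p), hx⟩ : D.Component) = Quot.mk _ ⟨(l', p'), hy⟩ := Quot.sound hxy
    exact (hgpos l p hx).trans (this ▸ (hgpos l' p' hy).symm))
  refine ⟨z, ?_⟩
  have : U = Finset.univ := by
    obtain ⟨l, p, h3, h4, h5⟩ := hpoint a
    obtain ⟨l', p', h6, h7, h8⟩ := hpoint b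
    have h9 := h2 l p h3 h4
    have h10 := h2 l' p' h6 h7
    rw [h5, decide_eq_true rfl] at h9
    rw [h8, decide_eq_false hab.symm] at h10
    refine Finset.eq_univ_of_forall fun c => ?_
    cases c
    · exact h10
    · exact h9
  rw [← this]
  exact h1

end LabelSystem
end LinkGame

/-! ### Positions of the game as a shape with a list of decorations -/

namespace LinkGame

/-- The decorations of the crossings, from top to bottom. -/
def Word.decorations {κ : Type} : Word κ → List κ
  | [] => []
  | ⟨_, .cap⟩ :: w => Word.decorations w
  | ⟨_, .cup⟩ :: w => Word.decorations w
  | ⟨_, .cross c⟩ :: w => c :: Word.decorations w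

/-- A word without the decorations of its crossings. -/
def Word.shape {κ : Type} (w : Word κ) : Word Unit := w.map fun _ => ()

namespace Word

variable {κ κ' : Type}

theorem map_cons (f : κ → κ') (c : Slice κ) (w : Word κ) :
    Word.map f (c :: w) = ⟨c.pos, c.piece.map f⟩ :: Word.map f w := rfl

theorem map_append (f : κ → κ') (v w : Word κ) :
    Word.map f (v ++ w) = Word.map f v ++ Word.map f w := List.map_append

theorem shape_append (v w : Word κ) : shape (v ++ w) = shape v ++ shape w := map_append _ v w

theorem shape_map (f : κ → κ') (w : Word κ) : shape (Word.map f w) = shape w := by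
  induction w with
  | nil => rfl
  | cons c w ih =>
    obtain ⟨i, g⟩ := c
    rw [map_cons, shape, map_cons, shape, map_cons]
    refine congrArg₂ List.cons ?_ ih
    cases g <;> rfl

theorem decorations_append (v w : Word κ) :
    decorations (v ++ w) = decorations v ++ decorations w := by
  induction v with
  | nil => rfl
  | cons c v ih =>
    obtain ⟨i, g⟩ := c
    cases g
    · exact ih
    · exact ih
    · exact congrArg _ ih

theorem decorations_map (f : κ → κ') (w : Word κ) :
    decorations (Word.map f w) = (decorations w).map f := by
  induction w with
  | nil => rfl
  | cons c w ih =>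
    obtain ⟨i, g⟩ := c
    cases g
    · exact ih
    · exact ih
    · exact congrArg _ ih

/-- This reduces the game to lists: the shape never changes, and a move replaces one entry `none` of
the list of decorations. -/
theorem ext_decorations {v w : Word κ} (h : v.shape = w.shape)
    (h' : v.decorations = w.decorations) : v = w := by
  induction v generalizing w with
  | nil => exact (List.map_eq_nil_iff.1 h.symm).symm
  | cons c v ih =>
    match w with
    | [] => simp [shape, Word.map] at h
    | d :: w =>
      obtain ⟨i, g⟩ := c
      obtain ⟨j, q⟩ := d
      obtain ⟨h1, h2⟩ := List.cons.inj h
      obtain ⟨rfl, h1⟩ := Slice.mk.inj h1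
      cases g <;> cases q <;> simp only [Piece.map, reduceCtorEq] at h1
      · exact congrArg _ (ih h2 h')
      · exact congrArg _ (ih h2 h')
      · obtain ⟨rfl, h3⟩ := List.cons.inj h'
        exact congrArg _ (ih h2 h3)

theorem exists_of_decorations_eq {w : Word κ} {l l' : List κ} {c : κ}
    (h : w.decorations = l ++ c :: l') : ∃ (A : Word κ) (i : ℕ) (B : Word κ),
      w = A ++ [⟨i, .cross c⟩] ++ B ∧ A.decorations = l ∧ B.decorations = l' := by
  induction w generalizing l with
  | nil => simp [decorations] at h
  | cons d w ih =>
    obtain ⟨i, g⟩ := d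
    cases g with
    | cap =>
      obtain ⟨A, j, B, rfl, h1, h2⟩ := ih h
      exact ⟨⟨i, .cap⟩ :: A, j, B, rfl, h1, h2⟩
    | cup =>
      obtain ⟨A, j, B, rfl, h1, h2⟩ := ih h
      exact ⟨⟨i, .cup⟩ :: A, j, B, rfl, h1, h2⟩
    | cross b =>
      match l with
      | [] =>
        obtain ⟨rfl, h3⟩ := List.cons.inj h
        exact ⟨[], i, w, rfl, rfl, h3⟩
      | x :: l =>
        obtain ⟨rfl, h3⟩ := List.cons.inj h
        obtain ⟨A, j, B, rfl, rfl, h2⟩ := ih h3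
        exact ⟨⟨i, .cross b⟩ :: A, j, B, rfl, rfl, h2⟩

theorem run_eq_of_shape_eq {v : Word κ} {w : Word κ'} (h : v.shape = w.shape) (m : ℕ) :
    v.run m = w.run m := by
  rw [← Word.run_map (fun _ => ()) v, ← Word.run_map (fun _ => ()) w]
  exact congrArg _ h

end Word

namespace LinkPseudodiagram

theorem Resolves.decorations {P Q : LinkPseudodiagram} (h : P.Resolves Q) :
    Q.word.shape = P.word.shape ∧ ∃ l l' b, P.word.decorations = l ++ none :: l' ∧
      Q.word.decorations = l ++ some b :: l' := by
  obtain ⟨A, B, i, b, h1, h2⟩ := h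
  rw [h1, h2]
  refine ⟨by simp only [Word.shape_append]; rfl, A.decorations, B.decorations, b, ?_, ?_⟩ <;>
  · simp only [Word.decorations_append]
    simp [Word.decorations]

theorem exists_resolves {P : LinkPseudodiagram} {l l' : List (Option Bool)}
    (h : P.word.decorations = l ++ none :: l') (b : Bool) : ∃ Q : LinkPseudodiagram,
      P.Resolves Q ∧ Q.word.shape = P.word.shape ∧ Q.word.decorations = l ++ some b :: l' := by
  obtain ⟨A, i, B, h1, h2, h3⟩ := Word.exists_of_decorations_eq h
  have hs : Word.shape (A ++ [⟨i, .cross (some b)⟩] ++ B) = P.word.shape := by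
    rw [h1]; simp only [Word.shape_append]; rfl
  refine ⟨⟨_, by rw [Word.run_eq_of_shape_eq hs]; exact P.closed⟩, ⟨A, B, i, b, h1, rfl⟩, hs, ?_⟩
  simp only [Word.decorations_append, ← h2, ← h3]
  simp [Word.decorations]

theorem exists_toPseudo {P : LinkPseudodiagram} (h : none ∉ P.word.decorations) :
    ∃ D : LinkDiagram, P = D.toPseudo ∧ D.word.shape = P.word.shape ∧
      D.word.decorations.map some = P.word.decorations := by
  have h1 : (P.word.decorations.map fun o => o.getD false).map some = P.word.decorations := by
    rw [List.map_map, List.map_congr_left (g := id), List.map_id]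
    intro o ho
    cases o with
    | none => exact absurd ho h
    | some b => rfl
  -- The default `false` is never used, since no crossing is unresolved.
  refine ⟨P.map fun o => o.getD false, ?_, Word.shape_map _ _, ?_⟩
  · obtain ⟨w, hw⟩ := P
    have : w = Word.map some (Word.map (fun o => o.getD false) w) :=
      Word.ext_decorations (by rw [Word.shape_map, Word.shape_map])
        (by rw [Word.decorations_map, Word.decorations_map]; exact h1.symm)
    simp only [LinkDiagram.toPseudo, Diagram.map]
    congr 1
  · exact (congrArg _ (Word.decorations_map _ _)).trans h1

end LinkPseudodiagram

/-! ### The two strategies of the second player -/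

theorem exists_split_of_mem {l : List (Option Bool)} (h : 0 < l.count none) :
    ∃ l₁ l₂, l = l₁ ++ none :: l₂ :=
  List.append_of_mem (List.count_pos_iff.1 h)

theorem exists_unit_add_ne_zero (t : ℤ) : ∃ b, t + unit b ≠ 0 := by
  by_cases h : t = -1
  · exact ⟨false, by simp [unit, h]⟩
  · exact ⟨true, by simp only [unit, if_true]; omega⟩

/-- The player who resolves the last crossing makes sure that the signs do not add up to zero. -/
theorem hasWinningStrategy_total_ne_zero {W : LinkDiagram → Prop} {P : LinkPseudodiagram}
    (hW : ∀ D : LinkDiagram, D.word.shape = P.word.shape → total D.word.decorations ≠ 0 → W D)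
    {k : ℕ} (hk : P.word.decorations.count none = 2 * k + 2) : HasWinningStrategy W false P := by
  induction k generalizing P with
  | zero =>
    obtain ⟨l₁, l₂, h1⟩ := exists_split_of_mem (l := P.word.decorations) (by omega)
    -- This only shows that the opponent has a move at all.
    obtain ⟨Q, hQ, -⟩ := LinkPseudodiagram.exists_resolves h1 true
    refine .opponentMove ⟨Q, hQ⟩ fun Q hQ => ?_
    obtain ⟨hs, l, l', b, h2, h3⟩ := hQ.decorations
    have h4 : Q.word.decorations.count none = 1 := by
      rw [h2] at hk
      rw [h3]
      simp at hk ⊢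
      omega
    obtain ⟨l₁, l₂, h5⟩ := exists_split_of_mem (l := Q.word.decorations) (by omega)
    -- All crossings in `l₁` and `l₂` are resolved by now, so the default value does not enter.
    obtain ⟨b, hb⟩ := exists_unit_add_ne_zero
      (total (l₁.map fun o => o.getD false) + total (l₂.map fun o => o.getD false))
    obtain ⟨Q', hQ', hs', h6⟩ := LinkPseudodiagram.exists_resolves h5 b
    refine .ownMove Q' hQ' ?_
    obtain ⟨D, h7, h8, h9⟩ := LinkPseudodiagram.exists_toPseudo (P := Q') (by
      rw [← List.count_eq_zero, h6]
      rw [h5] at h4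
      simp at h4 ⊢
      omega)
    refine .finished D h7 (hW D (by rw [h8, hs', hs]) ?_)
    have h10 : D.word.decorations = (l₁.map fun o => o.getD false) ++
        b :: (l₂.map fun o => o.getD false) := by
      have := congrArg (List.map fun o : Option Bool => o.getD false) (h9.trans h6)
      simpa [List.map_map, Function.comp_def] using this
    rw [h10]
    intro h11
    apply hb
    rw [← h11]
    simp only [total, List.map_append, List.map_cons, List.sum_append, List.sum_cons]
    ring
  | succ k ih =>
    obtain ⟨l₁, l₂, h1⟩ := exists_split_of_mem (l := P.word.decorations) (by omega)
    obtain ⟨Q, hQ, -⟩ := LinkPseudodiagram.exists_resolves h1 true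
    refine .opponentMove ⟨Q, hQ⟩ fun Q hQ => ?_
    obtain ⟨hs, l, l', b, h2, h3⟩ := hQ.decorations
    have h4 : Q.word.decorations.count none = 2 * k + 3 := by
      rw [h2] at hk
      rw [h3]
      simp at hk ⊢
      omega
    obtain ⟨l₁, l₂, h5⟩ := exists_split_of_mem (l := Q.word.decorations) (by omega)
    -- Before the last round any reply will do.
    obtain ⟨Q', hQ', hs', h6⟩ := LinkPseudodiagram.exists_resolves h5 true
    refine .ownMove Q' hQ' (ih (fun D hD => hW D (by rw [hD, hs', hs])) ?_)
    rw [h5] at h4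
    rw [h6]
    simp at h4 ⊢
    omega

/-- Two crossings that are both unresolved or resolved in opposite ways. -/
def Opposite (x y : Option Bool) : Prop := y = x.map not

theorem Opposite.symm {x y : Option Bool} (h : Opposite x y) : Opposite y x := by
  subst h
  cases x <;> simp [Opposite]

/-- Partners are resolved in the same round, so the partner of an unresolved crossing is unresolved.
After the move `b` it is still available, and the answer `!b` there restores the pairing. -/
theorem Paired.respond {l₁ l₂ : List (Option Bool)} (h : Paired Opposite (l₁ ++ none :: l₂))
    (b : Bool) : ∃ l₁' l₂', l₁ ++ some b :: l₂ = l₁' ++ none :: l₂' ∧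
      Paired Opposite (l₁' ++ some (!b) :: l₂') := by
  generalize hl : l₁ ++ none :: l₂ = l at h
  induction h generalizing l₁ with
  | nil => simp at hl
  | @cons x y l hxy hp ih =>
    match l₁ with
    | [] =>
      obtain ⟨rfl, rfl⟩ := List.cons.inj hl
      obtain rfl : y = none := hxy
      exact ⟨[some b], l, rfl, .cons rfl hp⟩
    | [z] =>
      simp only [List.cons_append, List.nil_append, List.cons.injEq] at hl
      obtain ⟨rfl, rfl, rfl⟩ := hl
      obtain rfl : z = none := hxy.symm
      exact ⟨[], some b :: l₂, rfl, .cons (by simp [Opposite]) hp⟩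
    | z :: z' :: l₁ =>
      simp only [List.cons_append, List.cons.injEq] at hl
      obtain ⟨rfl, rfl, hl⟩ := hl
      obtain ⟨l₁', l₂', h1, h2⟩ := ih hl
      exact ⟨z :: z' :: l₁', l₂', by simp [h1], .cons hxy h2⟩

/-- The first entry is opposite to the last one, the second to the third one and so on. -/
def CyclicallyPaired (l : List (Option Bool)) : Prop :=
  ∃ x m y, l = x :: (m ++ [y]) ∧ Opposite x y ∧ Paired Opposite m

theorem CyclicallyPaired.respond {l₁ l₂ : List (Option Bool)}
    (h : CyclicallyPaired (l₁ ++ none :: l₂)) (b : Bool) : ∃ l₁' l₂',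
      l₁ ++ some b :: l₂ = l₁' ++ none :: l₂' ∧ CyclicallyPaired (l₁' ++ some (!b) :: l₂') := by
  obtain ⟨x, m, y, h1, h2, h3⟩ := h
  match l₁ with
  | [] =>
    obtain ⟨rfl, rfl⟩ := List.cons.inj h1
    obtain rfl : y = none := h2
    exact ⟨some b :: m, [], rfl, some b, m, some (!b), rfl, rfl, h3⟩
  | z :: l₁ =>
    obtain ⟨rfl, h1'⟩ := List.cons.inj h1
    rcases List.eq_nil_or_concat l₂ with rfl | ⟨l₂, y', rfl⟩
    · obtain ⟨rfl, h4⟩ := List.append_inj' h1' rfl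
      obtain rfl : none = y := by simpa using h4
      obtain rfl : z = none := h2.symm
      exact ⟨[], l₁ ++ [some b], rfl, some (!b), l₁, some b, rfl, by simp [Opposite], h3⟩
    · have h1' : (l₁ ++ none :: l₂) ++ [y'] = m ++ [y] := by simpa using h1'
      obtain ⟨rfl, h4⟩ := List.append_inj' h1' rfl
      obtain rfl : y' = y := by simpa using h4
      obtain ⟨l₁', l₂', h5, h6⟩ := h3.respond b
      exact ⟨z :: l₁', l₂' ++ [y'],
        by simpa using congrArg (fun l => z :: (l ++ [y'])) h5,
        z, _, y', by simp, h2, h6⟩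

theorem paired_map_some {d : List Bool} (h : Paired Opposite (d.map some)) :
    Paired (fun x y => y = !x) d := by
  generalize hl : d.map some = l at h
  induction h generalizing d with
  | nil => obtain rfl := List.map_eq_nil_iff.1 hl; exact .nil
  | @cons x y l hxy _ ih =>
    match d with
    | [] | [_] => simp at hl
    | a :: b :: d =>
      simp only [List.map_cons, List.cons.injEq] at hl
      obtain ⟨rfl, rfl, hl⟩ := hl
      exact .cons (by simpa [Opposite] using hxy) (ih hl)

/-- The player who does not start always resolves the crossing that is paired with the one resolved
before, in the opposite way. -/
theorem hasWinningStrategy_paired {W : LinkDiagram → Prop} {P : LinkPseudodiagram}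
    (hW : ∀ (D : LinkDiagram) (x : Bool) (m : List Bool), D.word.shape = P.word.shape →
      D.word.decorations = x :: (m ++ [!x]) → Paired (fun x y => y = !x) m → W D)
    (hP : CyclicallyPaired P.word.decorations) : HasWinningStrategy W false P := by
  generalize hk : P.word.decorations.count none = k
  -- Each round resolves two crossings, hence the strong induction.
  induction k using Nat.strong_induction_on generalizing P with
  | _ k ih =>
    rcases Nat.eq_zero_or_pos k with rfl | hpos
    · obtain ⟨D, h1, h2, h3⟩ := LinkPseudodiagram.exists_toPseudo (List.count_eq_zero.1 hk)
      refine .finished D h1 ?_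
      obtain ⟨x, m, y, h4, h5, h6⟩ := hP
      rw [h4] at h3
      obtain ⟨x, d, h7, rfl, h8⟩ := List.map_eq_cons_iff.1 h3
      obtain ⟨d₁, d₂, rfl, rfl, h9⟩ := List.map_eq_append_iff.1 h8
      obtain ⟨y, rfl, rfl⟩ := List.map_eq_singleton_iff.1 h9
      obtain rfl : y = !x := by simpa [Opposite] using h5
      exact hW D x d₁ h2 h7 (paired_map_some h6)
    · obtain ⟨l₁, l₂, h1⟩ := exists_split_of_mem (l := P.word.decorations) (by omega)
      obtain ⟨Q, hQ, -⟩ := LinkPseudodiagram.exists_resolves h1 true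
      refine .opponentMove ⟨Q, hQ⟩ fun Q hQ => ?_
      obtain ⟨hs, l, l', b, h2, h3⟩ := hQ.decorations
      rw [h2] at hP hk
      obtain ⟨l₁', l₂', h4, h5⟩ := hP.respond b
      rw [h4] at h3
      obtain ⟨Q', hQ', hs', h6⟩ := LinkPseudodiagram.exists_resolves h3 (!b)
      have h7 := congrArg (List.count none) h4
      refine .ownMove Q' hQ' (ih (Q'.word.decorations.count none) ?_
        (fun D x m hD => hW D x m (by rw [hD, hs', hs])) (by rw [h6]; exact h5) rfl)
      rw [h6]
      simp at h7 hk ⊢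
      omega

/-! ### Equivalence of tangles and cancellation of opposite twists -/

/-- Apply a local move inside a tangle with `m` endpoints at its top and `n` at its bottom. -/
def TangleStep (m n : ℕ) (w w' : Word Bool) : Prop :=
  (∃ A B L R : Word Bool, Move L R ∧ w = A ++ L ++ B ∧ w' = A ++ R ++ B) ∧
    w.run m = some n ∧ w'.run m = some n

/-- A finite sequence of planar isotopies and Reidemeister moves leads from one tangle to another. -/
def TangleEquivalent (m n : ℕ) (w w' : Word Bool) : Prop :=
  Relation.EqvGen (TangleStep m n) w w'

namespace TangleEquivalent

variable {m n k l : ℕ} {w w' w'' T : Word Bool}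

theorem symm (h : TangleEquivalent m n w w') : TangleEquivalent m n w' w :=
  Relation.EqvGen.symm _ _ h

theorem trans (h : TangleEquivalent m n w w') (h' : TangleEquivalent m n w' w'') :
    TangleEquivalent m n w w'' := Relation.EqvGen.trans _ _ _ h h'

theorem of_move (h : Move w w') (hw : w.run m = some n) (hw' : w'.run m = some n) :
    TangleEquivalent m n w w' :=
  .rel _ _ ⟨⟨[], [], w, w', h, by simp, by simp⟩, hw, hw'⟩

theorem lift {f : Word Bool → Word Bool}
    (hf : ∀ w w', TangleStep m n w w' → TangleStep k l (f w) (f w'))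
    (h : TangleEquivalent m n w w') : TangleEquivalent k l (f w) (f w') := by
  induction h with
  | rel _ _ h => exact .rel _ _ (hf _ _ h)
  | refl => exact Relation.EqvGen.refl _
  | symm _ _ _ ih => exact ih.symm
  | trans _ _ _ _ _ ih₁ ih₂ => exact ih₁.trans ih₂

theorem frame (h : TangleEquivalent m n w w') (A B : Word Bool) (hA : A.run k = some m)
    (hB : B.run n = some l) : TangleEquivalent k l (A ++ w ++ B) (A ++ w' ++ B) := by
  refine lift (f := fun w => A ++ w ++ B) ?_ h
  rintro _ _ ⟨⟨A', B', L, R, hm, rfl, rfl⟩, h1, h2⟩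
  refine ⟨⟨A ++ A', B' ++ B, L, R, hm, by simp, by simp⟩, ?_, ?_⟩
  · rw [Word.run_append, Word.run_append, hA, Option.bind_some, h1, Option.bind_some, hB]
  · rw [Word.run_append, Word.run_append, hA, Option.bind_some, h2, Option.bind_some, hB]

theorem add (h : TangleEquivalent m n w w') (r : ℕ) :
    TangleEquivalent (m + r) (n + r) w w' :=
  lift (f := id) (fun _ _ h => ⟨h.1, Word.run_add r _ _ _ h.2.1, Word.run_add r _ _ _ h.2.2⟩) h

theorem _root_.LinkGame.Move.shift {L R : Word Bool} (h : Move L R) (k : ℕ) :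
    Move (L.shift k) (R.shift k) := by
  cases h with
  | interchange s t i j =>
    have := Move.interchange s t (k + i) j
    simpa [Word.shift, add_assoc] using this
  | zigzagLeft i => exact .zigzagLeft (k + i)
  | zigzagRight i => exact .zigzagRight (k + i)
  | swingCup i b => exact .swingCup (k + i) b
  | swingCap i b => exact .swingCap (k + i) b
  | R1Cap i b => exact .R1Cap (k + i) b
  | R1Cup i b => exact .R1Cup (k + i) b
  | R2 i b => exact .R2 (k + i) b
  | R3 i a b c h => exact .R3 (k + i) a b c h

theorem shift (h : TangleEquivalent m n w w') (k : ℕ) :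
    TangleEquivalent (k + m) (k + n) (w.shift k) (w'.shift k) := by
  refine lift (f := fun w => w.shift k) ?_ h
  rintro _ _ ⟨⟨A, B, L, R, hm, rfl, rfl⟩, h1, h2⟩
  exact ⟨⟨A.shift k, B.shift k, _, _, hm.shift k, by simp [Word.shift], by simp [Word.shift]⟩,
    Word.run_shift k 0 _ _ _ h1, Word.run_shift k 0 _ _ _ h2⟩

/-- Needed to recognize the intermediate words of a chain of moves as diagrams. The reflexive case
says nothing about the number of strands, so only an equivalence can be claimed. -/
theorem run_iff (h : TangleEquivalent m n w w') : w.run m = some n ↔ w'.run m = some n := by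
  induction h with
  | rel _ _ h => exact ⟨fun _ => h.2.2, fun _ => h.2.1⟩
  | refl => rfl
  | symm _ _ _ ih => exact ih.symm
  | trans _ _ _ _ _ ih₁ ih₂ => exact ih₁.trans ih₂

theorem equivalent (h : TangleEquivalent 0 0 w w') (hw : w.run 0 = some 0)
    (hw' : w'.run 0 = some 0) : LinkDiagram.Equivalent ⟨w, hw⟩ ⟨w', hw'⟩ := by
  induction h with
  | rel _ _ h => exact .rel _ _ h.1
  | refl => exact Relation.EqvGen.refl _
  | symm _ _ _ ih => exact Relation.EqvGen.symm _ _ (ih hw' hw)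
  | trans _ _ _ h _ ih₁ ih₂ =>
    have hy := (run_iff h).1 hw
    exact .trans _ _ _ (ih₁ hw hy) (ih₂ hy hw')

/-- Move a piece on the right of a tangle from its top to its bottom. -/
theorem past (g : Piece Bool) (j : ℕ) (hT : T.run m = some n) :
    TangleEquivalent (m + j + g.inn) (n + j + g.out) ([⟨m + j, g⟩] ++ T) (T ++ [⟨n + j, g⟩]) := by
  induction T generalizing m with
  | nil =>
    obtain rfl := Option.some.inj hT
    exact Relation.EqvGen.refl _
  | cons c T ih =>
    obtain ⟨i, p⟩ := c
    rw [Word.run] at hT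
    split at hT
    · rename_i hi
      dsimp only at hi hT
      obtain ⟨d, rfl⟩ := Nat.exists_eq_add_of_le hi
      have h1 : TangleEquivalent (i + p.inn + d + j + g.inn)
          (i + p.inn + d - p.inn + p.out + j + g.out)
          [⟨i + p.inn + d + j, g⟩, ⟨i, p⟩] [⟨i, p⟩, ⟨i + p.inn + d - p.inn + p.out + j, g⟩] := by
        have h := Move.interchange p g i (d + j)
        rw [show i + p.inn + d - p.inn + p.out + j = i + p.out + (d + j) by omega,
          show i + p.inn + d + j = i + p.inn + (d + j) by omega]
        refine (of_move h ?_ ?_).symm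
        · rw [Word.run, if_pos (by dsimp only; omega), Word.run,
            if_pos (by dsimp only; omega), Word.run]
          dsimp only
          congr 1
          omega
        · rw [Word.run, if_pos (by dsimp only; omega), Word.run,
            if_pos (by dsimp only; omega), Word.run]
          dsimp only
          congr 1
          omega
      have h2 := h1.frame [] T rfl
        (by simpa only [← add_assoc] using Word.run_add (j + g.out) _ _ _ hT)
      have h3 := (ih hT).frame [⟨i, p⟩] [] (k := i + p.inn + d + j + g.inn) (by
        rw [Word.run, if_pos (by dsimp only; omega), Word.run]
        dsimp only
        congr 1
        omega) rfl
      simpa using h2.trans (by simpa using h3)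
    · simp at hT

end TangleEquivalent

open TangleEquivalent

theorem tangleEquivalent_bottomTwist {c : Bool} {T T' : Word Bool}
    (h : TangleEquivalent 2 2 T T') : TangleEquivalent 2 2 (bottomTwist c T) (bottomTwist c T') :=
  h.frame [] [⟨0, .cross c⟩] rfl rfl

theorem tangleEquivalent_rightTwist {c : Bool} {T T' : Word Bool}
    (h : TangleEquivalent 2 2 T T') : TangleEquivalent 2 2 (rightTwist c T) (rightTwist c T') :=
  (h.add 2).frame [⟨1, .cap⟩] [⟨2, .cross c⟩, ⟨1, .cup⟩] rfl rfl

theorem tangleEquivalent_twistAlong (l : List (Bool × Bool)) {T T' : Word Bool}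
    (h : TangleEquivalent 2 2 T T') : TangleEquivalent 2 2 (twistAlong l T) (twistAlong l T') := by
  induction l generalizing T T' with
  | nil => exact h
  | cons x l ih =>
    obtain ⟨f, c⟩ := x
    cases f
    · exact ih (tangleEquivalent_rightTwist h)
    · exact ih (tangleEquivalent_bottomTwist h)

theorem tangleEquivalent_closure (c : Closure) {T T' : Word Bool}
    (h : TangleEquivalent 2 2 T T') : TangleEquivalent 0 0 (c.word T) (c.word T') := by
  cases c
  · exact h.frame [⟨0, .cap⟩] [⟨0, .cup⟩] rfl rfl
  · exact ((h.shift 1).add 1).frame [⟨0, .cap⟩, ⟨2, .cap⟩] [⟨0, .cup⟩, ⟨0, .cup⟩] rfl rfl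

theorem bottomTwist_cancel {T : Word Bool} (hT : T.run 2 = some 2) (b : Bool) :
    TangleEquivalent 2 2 (bottomTwist (!b) (bottomTwist b T)) T := by
  have h : TangleEquivalent 2 2 _ _ := of_move (.R2 0 b) rfl rfl
  simpa [bottomTwist] using h.frame T [] hT rfl

/-- The part to the right of the tangle after two opposite right twists. Swinging the upper crossing
around the maximum and the lower one around a minimum puts them on top of each other with opposite
decorations; after R2 a zigzag is left, which is straightened. -/
theorem horizontal_cancel (b : Bool) : TangleEquivalent 4 2
    [⟨3, .cap⟩, ⟨2, .cross b⟩, ⟨1, .cup⟩, ⟨2, .cross (!b)⟩, ⟨1, .cup⟩] [⟨2, .cup⟩] := by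
  have h1 : TangleEquivalent 4 6 _ _ := of_move (.swingCap 2 b) rfl rfl
  have h2 : TangleEquivalent 6 4 _ _ := of_move (.interchange .cup (.cross (!b)) 1 1) rfl rfl
  have h3 : TangleEquivalent 6 2 _ _ := of_move (.interchange .cup .cup 1 0) rfl rfl
  have h4 : TangleEquivalent 6 4 _ _ := of_move (.swingCup 3 b) rfl rfl
  have h5 : TangleEquivalent 6 6 _ _ := of_move (.R2 3 (!b)) rfl rfl
  have h6 : TangleEquivalent 4 4 _ _ := of_move (.interchange .cap .cup 2 0) rfl rfl
  have h7 : TangleEquivalent 2 2 _ _ := of_move (.zigzagRight 1) rfl rfl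
  rw [Bool.not_not] at h5
  exact (h1.frame [] [⟨1, .cup⟩, ⟨2, .cross (!b)⟩, ⟨1, .cup⟩] rfl rfl).trans <|
    (h2.frame [⟨2, .cap⟩, ⟨3, .cross (!b)⟩] [⟨1, .cup⟩] rfl rfl).trans <|
    (h3.frame [⟨2, .cap⟩, ⟨3, .cross (!b)⟩, ⟨4, .cross (!b)⟩] [] rfl rfl).trans <|
    (h4.symm.frame [⟨2, .cap⟩, ⟨3, .cross (!b)⟩] [⟨1, .cup⟩] rfl rfl).trans <|
    (h5.frame [⟨2, .cap⟩] [⟨4, .cup⟩, ⟨1, .cup⟩] rfl rfl).trans <|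
    (h6.frame [] [⟨1, .cup⟩] rfl rfl).trans (h7.frame [⟨2, .cup⟩] [] rfl rfl)

/-- The maximum of the outer strand slides down past the tangle, next to the two crossings, which
then cancel by `horizontal_cancel`. The remaining minimum slides up past the tangle and forms a
zigzag with the other maximum. -/
theorem rightTwist_cancel {T : Word Bool} (hT : T.run 2 = some 2) (b : Bool) :
    TangleEquivalent 2 2 (rightTwist (!b) (rightTwist b T)) T := by
  have hT' := Word.run_add 2 _ _ _ hT
  have hT'' := Word.run_add 4 _ _ _ hT
  have h1 : TangleEquivalent 2 6 _ _ := of_move (.interchange .cap .cap 1 0) rfl rfl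
  have h2 := ((past .cap 1 hT).add 1).frame (k := 2) (l := 2) [⟨1, .cap⟩]
    [⟨2, .cross b⟩, ⟨1, .cup⟩, ⟨2, .cross (!b)⟩, ⟨1, .cup⟩] rfl rfl
  have h3 := (horizontal_cancel b).frame (k := 2) (l := 2) ([⟨1, .cap⟩] ++ T) [] (by
    rw [Word.run_append]; exact hT') rfl
  have h4 := (past .cup 0 hT).symm.frame (k := 2) (l := 2) [⟨1, .cap⟩] [] rfl rfl
  have h5 : TangleEquivalent 2 2 _ _ := of_move (.zigzagLeft 1) rfl rfl
  have h0 := h1.symm.frame (k := 2) (l := 2) []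
    (T ++ [⟨2, .cross b⟩, ⟨1, .cup⟩, ⟨2, .cross (!b)⟩, ⟨1, .cup⟩]) rfl (by
    rw [Word.run_append, hT'']; rfl)
  have h6 := h5.frame (k := 2) (l := 2) [] T rfl hT
  simp [Piece.inn, Piece.out] at h0 h2 h3 h4 h6
  have := h0.trans (h2.trans (h3.trans (h4.trans h6)))
  simpa [rightTwist] using this

theorem twistAlong_paired_cancel {l : List (Bool × Bool)}
    (hf : Paired (· = ·) (l.map Prod.fst)) (hd : Paired (fun x y => y = !x) (l.map Prod.snd))
    {T : Word Bool} (hT : T.run 2 = some 2) : TangleEquivalent 2 2 (twistAlong l T) T := by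
  generalize hm : l.map Prod.fst = m at hf
  induction hf generalizing l with
  | nil =>
    obtain rfl := List.map_eq_nil_iff.1 hm
    exact Relation.EqvGen.refl _
  | @cons f g m hfg _ ih =>
    subst hfg
    match l with
    | [] | [_] => simp at hm
    | (f₁, b₁) :: (f₂, b₂) :: l =>
      simp only [List.map_cons, List.cons.injEq] at hm
      obtain ⟨rfl, rfl, hm⟩ := hm
      obtain ⟨hb, hd'⟩ : b₂ = (!b₁) ∧ Paired (fun x y => y = !x) (l.map Prod.snd) := by
        cases hd with
        | cons h h' => exact ⟨h, h'⟩
      subst hb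
      -- The earliest pair cancels directly above `T`, and the later twists carry this equivalence
      -- along.
      refine (tangleEquivalent_twistAlong l ?_).trans (ih hd' hm)
      cases f₂
      · exact rightTwist_cancel hT b₁
      · exact bottomTwist_cancel hT b₁

/-- Once the paired twists are gone, only the first and the last crossing are left, and they are
opposite. -/
theorem splittable_of_paired {f x : Bool} {l : List (Bool × Bool)}
    (hf : Paired (· = ·) (l.map Prod.fst)) (hd : Paired (fun x y => y = !x) (l.map Prod.snd))
    {D : LinkDiagram}
    (hD : D.word = (goodClosure f).word (twistAlong ((true, x) :: (l ++ [(f, !x)])) [])) :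
    D.Splittable := by
  have h1 : TangleEquivalent 2 2 (twistAlong ((true, x) :: (l ++ [(f, !x)])) [])
      (twistAlong [(f, !x)] [⟨0, .cross x⟩]) := by
    rw [twistAlong, twistAlong_append]
    exact tangleEquivalent_twistAlong _ (twistAlong_paired_cancel hf hd rfl)
  have h2 := tangleEquivalent_closure (goodClosure f) h1
  rw [← hD] at h2
  let E : LinkDiagram := ⟨[⟨0, .cap⟩, ⟨0, .cup⟩], rfl⟩
  cases f with
  | true =>
    have h3 : TangleEquivalent 2 2 (twistAlong [(true, !x)] [⟨0, .cross x⟩]) [] :=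
      bottomTwist_cancel (T := []) rfl x
    -- The right circle is closed first, so that its two slices are adjacent and can be removed as
    -- the inner diagram.
    have h4 : TangleEquivalent 4 0 _ _ := of_move (.interchange .cup .cup 0 0) rfl rfl
    have h5 := h2.trans ((tangleEquivalent_closure .denominator h3).trans
      (h4.frame [⟨0, .cap⟩, ⟨2, .cap⟩] [] rfl rfl))
    exact ⟨⟨_, h5.run_iff.1 D.closed⟩, h5.equivalent D.closed _,
      E, E, [⟨0, .cap⟩], [⟨0, .cup⟩], 2, by simp [E], by simp [E], rfl, rfl⟩
  | false =>
    have h3 : TangleEquivalent 2 4 _ _ := of_move (.swingCap 0 x) rfl rfl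
    have h4 : TangleEquivalent 4 2 _ _ := of_move (.swingCup 1 x) rfl rfl
    have h5 : TangleEquivalent 4 4 _ _ := of_move (.R2 1 (!x)) rfl rfl
    have h6 : TangleEquivalent 2 2 _ _ := of_move (.interchange .cap .cup 0 0) rfl rfl
    rw [Bool.not_not] at h5
    -- Both crossings swing to the strands in the middle and cancel there. The numerator closure of
    -- what is left consists of two circles, one above the other.
    have h7 : TangleEquivalent 2 2 (twistAlong [(false, !x)] [⟨0, .cross x⟩])
        [⟨0, .cup⟩, ⟨0, .cap⟩] :=
      (h3.frame [] [⟨2, .cross (!x)⟩, ⟨1, .cup⟩] rfl rfl).trans <|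
      (h4.symm.frame [⟨0, .cap⟩, ⟨1, .cross (!x)⟩] [] rfl rfl).trans <|
      (h5.frame [⟨0, .cap⟩] [⟨2, .cup⟩] rfl rfl).trans h6
    have h8 := h2.trans (tangleEquivalent_closure .numerator h7)
    exact ⟨⟨_, h8.run_iff.1 D.closed⟩, h8.equivalent D.closed _,
      E, E, [], [⟨0, .cap⟩, ⟨0, .cup⟩], 0, by simp [E], by simp [E], rfl, rfl⟩

/-! ### Resolutions of the shadow and conclusion -/

/-- A right twist puts a maximum on top of the tangle but its crossing below it, so the crossings
from top to bottom are in the order of the twists. This matches the pairing of decorations with the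
pairing of twists. -/
theorem decorations_twistAlong {κ : Type} (l : List (Bool × κ)) (T : Word κ) :
    (twistAlong l T).decorations = T.decorations ++ l.map Prod.snd := by
  induction l generalizing T with
  | nil => simp [twistAlong]
  | cons x l ih =>
    obtain ⟨f, c⟩ := x
    rw [twistAlong, ih]
    cases f <;>
      simp [bottomTwist, rightTwist, Word.decorations_append, Word.decorations]

theorem decorations_shift {κ : Type} (k : ℕ) (w : Word κ) :
    (w.shift k).decorations = w.decorations := by
  induction w with
  | nil => rfl
  | cons c w ih =>
    obtain ⟨i, g⟩ := c
    cases g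
    · exact ih
    · exact ih
    · exact congrArg (List.cons _) ih

theorem decorations_closure {κ : Type} (c : Closure) (T : Word κ) :
    (c.word T).decorations = T.decorations := by
  cases c <;>
    simp [Closure.word, numeratorWord, denominatorWord, Word.decorations_append, Word.decorations,
      decorations_shift]

theorem shape_shift {κ : Type} (k : ℕ) (w : Word κ) : (w.shift k).shape = w.shape.shift k := by
  simp [Word.shape, Word.map, Word.shift]

theorem shape_closure {κ κ' : Type} (c : Closure) {T : Word κ} {T' : Word κ'}
    (h : T.shape = T'.shape) : (c.word T).shape = (c.word T').shape := by
  cases c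
  · simp only [Closure.word, numeratorWord, Word.shape_append, h]
    rfl
  · simp only [Closure.word, denominatorWord, Word.shape_append, shape_shift, h]
    rfl

theorem shape_twistAlong {κ κ' : Type} {l : List (Bool × κ)} {l' : List (Bool × κ')}
    (hl : l.map Prod.fst = l'.map Prod.fst) {T : Word κ} {T' : Word κ'}
    (h : T.shape = T'.shape) : (twistAlong l T).shape = (twistAlong l' T').shape := by
  induction l generalizing l' T T' with
  | nil =>
    obtain rfl := List.map_eq_nil_iff.1 hl.symm
    exact h
  | cons x l ih =>
    match l' with
    | [] => simp at hl
    | y :: l' =>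
      obtain ⟨f, c⟩ := x
      obtain ⟨f', c'⟩ := y
      simp only [List.map_cons, List.cons.injEq] at hl
      obtain ⟨rfl, hl⟩ := hl
      refine ih hl ?_
      cases f
      · simp only [rightTwist, Word.shape_append, h, Bool.false_eq_true, if_false]
        rfl
      · simp only [bottomTwist, Word.shape_append, h, if_true]
        rfl

theorem length_decorations_eq {κ κ' : Type} {v : Word κ} {w : Word κ'} (h : v.shape = w.shape) :
    v.decorations.length = w.decorations.length := by
  have := congrArg (fun w => w.decorations.length) h
  simpa [Word.shape, Word.decorations_map] using this

/-- A resolution of all crossings is given by the same twists with other signs. -/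
theorem exists_twistAlong_eq {κ κ' : Type} {c : Closure} {l : List (Bool × κ)} {w : Word κ'}
    (h : w.shape = (c.word (twistAlong l [])).shape) : ∃ l' : List (Bool × κ'),
      l'.map Prod.fst = l.map Prod.fst ∧ l'.map Prod.snd = w.decorations ∧
        w = c.word (twistAlong l' []) := by
  have hlen : w.decorations.length = l.length := by
    rw [length_decorations_eq h, decorations_closure, decorations_twistAlong]
    simp [Word.decorations]
  have h1 : ((l.map Prod.fst).zip w.decorations).map Prod.fst = l.map Prod.fst :=
    List.map_fst_zip (by simp [hlen])
  have h2 : ((l.map Prod.fst).zip w.decorations).map Prod.snd = w.decorations :=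
    List.map_snd_zip (by simp [hlen])
  refine ⟨_, h1, h2, Word.ext_decorations ?_ ?_⟩
  · rw [h]
    exact shape_closure c (shape_twistAlong h1.symm rfl)
  · rw [decorations_closure, decorations_twistAlong, h2]
    rfl

theorem secondPlayerHasWinningStrategy_rationalLink {a b : ℤ} {as : List ℤ} (ha : Odd a)
    (has : ∀ x ∈ as, Even x) (hb : Odd b) {c : Closure}
    (hc : (rationalLink c (a :: (as ++ [b]))).numComponents = 2) (r : Role) :
    SecondPlayerHasWinningStrategy r (rationalLink c (a :: (as ++ [b]))).shadow := by
  obtain ⟨m, f, hm, hl⟩ := map_fst_syllableTwists a b as ha has hb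
  have hw := rationalLink_word c (a :: (as ++ [b]))
  generalize syllableTwists true (a :: (as ++ [b])) = l at hl hw
  generalize rationalLink c (a :: (as ++ [b])) = D at hc hw
  obtain ⟨z, hz⟩ := LinkDiagram.exists_plain_labelled hc
  rw [hw] at hz
  obtain rfl := eq_goodClosure hm hl hz
  have hs : D.shadow.word.shape = ((goodClosure f).word (twistAlong l [])).shape := by
    rw [← hw]
    exact Word.shape_map _ _
  have hlen : l.length = m.length + 2 := by simpa using congrArg List.length hl
  have hd : D.shadow.word.decorations = List.replicate (m.length + 2) none := by
    refine (Word.decorations_map _ _).trans ?_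
    rw [hw, decorations_closure, decorations_twistAlong, ← hlen]
    simp [Word.decorations, List.map_map, Function.comp_def, List.map_const']
  obtain ⟨k, hk⟩ := hm.length_even
  cases r with
  | linker =>
    -- There are `m.length + 2` crossings and `m.length = k + k`.
    refine hasWinningStrategy_total_ne_zero (k := k) (fun D' hD' h0 => ?_) ?_
    · obtain ⟨l', h1, h2, h3⟩ := exists_twistAlong_eq (hD'.trans hs)
      rw [← h2] at h0
      exact not_splittable_of_total_ne_zero hm (h1.trans hl) h0 h3
    · rw [hd, List.count_replicate_self]
      omega
  | unlinker =>
    refine hasWinningStrategy_paired (fun D' x d hD' hx hp => ?_) ?_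
    · obtain ⟨l', h1, h2, h3⟩ := exists_twistAlong_eq (hD'.trans hs)
      obtain ⟨⟨g, y⟩, l₁, rfl, rfl, h4⟩ := List.map_eq_cons_iff.1 (h1.trans hl)
      obtain ⟨l₂, l₃, rfl, rfl, h5⟩ := List.map_eq_append_iff.1 h4
      obtain ⟨⟨g', y'⟩, rfl, rfl⟩ := List.map_eq_singleton_iff.1 h5
      rw [hx, List.map_cons, List.map_append, List.cons.injEq] at h2
      obtain ⟨rfl, h2⟩ := h2
      obtain ⟨rfl, h6⟩ := List.append_inj' h2 rfl
      obtain rfl : y' = !y := by simpa using h6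
      exact splittable_of_paired hm hp h3
    · rw [hd]
      refine ⟨none, List.replicate m.length none, none, ?_, rfl,
        paired_replicate (show Opposite none none from rfl) hm.length_even⟩
      rw [List.replicate_succ, List.replicate_succ']

end LinkGame

theorem theorem4p3 (n : ℕ) (hn : 3 ≤ n) (a : Fin n → ℤ)
    (hfirst : Odd (a ⟨0, by omega⟩)) (hlast : Odd (a ⟨n - 1, by omega⟩))
    (hmiddle : ∀ i : Fin n, 0 < (i : ℕ) → (i : ℕ) < n - 1 → Even (a i))
    (c : LinkGame.Closure)
    (hcomp : (LinkGame.rationalLink c (List.ofFn a)).numComponents = 2)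
    (r : LinkGame.Role) :
    LinkGame.SecondPlayerHasWinningStrategy r
      (LinkGame.rationalLink c (List.ofFn a)).shadow := by
  obtain ⟨k, rfl⟩ : ∃ k, n = k + 2 := ⟨n - 2, by omega⟩
  have h : List.ofFn a = a 0 :: (List.ofFn (fun i : Fin k => a i.castSucc.succ) ++
      [a (Fin.last (k + 1))]) := by
    rw [List.ofFn_succ, List.ofFn_succ', List.concat_eq_append]
    rfl
  rw [h] at hcomp ⊢
  refine LinkGame.secondPlayerHasWinningStrategy_rationalLink hfirst ?_ hlast hcomp r
  intro x hx
  obtain ⟨i, rfl⟩ := (List.mem_ofFn' _ _).1 hx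
  exact hmiddle _ (by simp) (by simp)
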